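/- **Setting.** Let $d\ge 0$, let $\varsigma\in\{1,-1\}$, and let $$H(u,\bar u)=|u|^4+\sum_{l+l'\ge 5}\alpha_{l,l'}u^l\bar u^{l'},\qquad \alpha_{l,l'}=\alpha_{l',l}\in\mathbb R,$$ be analytic near $0$. Consider, for $x\in\mathbb T^d=(\mathbb R/2\pi\mathbb Z)^d$, $$iu_t-\Delta u+\rho u-\varsigma\,\Delta\Big(\frac{\partial H}{\partial\bar u}(u,\bar u)\Big)=0.\tag{1}$$ Let $|\cdot|$ be the Euclidean norm. For $n_1,\dots,n_b\in\mathbb Z^d$ and real $a=(a_1,\dots,a_b)$ put $\omega_{n}=|n|^2+\rho$ and $\omega_0=(\omega_{n_1},\dots,\omega_{n_b})$. Then $u_0=\sum_{j=1}^b a_je^{in_j\cdot x+i\omega_{n_j}t}$ solves the linear equation $iu_t-\Delta u+\rho u=0$. Fix $\sigma>0$, $s>b/2$ and $0<\kappa<2$. We say that $u_0$ *persists with frequency* $\omega\in\mathbb R^b$ (with constant $C$) if (1) has a classical solution $$u(x,t)=\sum_{n\in\mathbb Z^d,\,k\in\mathbb Z^b}\hat u(n,k)e^{in\cdot x+ik\cdot\omega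 t}$$ with values in the domain of convergence of $H$, such that $\hat u(n_j,e_j)=a_j$ for all $j$, $$\Big(\sum_{(n,k)\notin\{(n_j,e_j)\}}|\hat u(n,k)|^2|(n,k)|^{2s}e^{2\sigma|(n,k)|}\Big)^{1/2}<|a|^{1+\kappa},\qquad |\omega-\omega_0|\le C|a|^2 .$$ **Statement.** Suppose that for some $\gamma>0$, $\tau>1$ we have $|m\rho-l|\ge\gamma/|m|^{\tau}$ for all integers $l$ and $m\ne 0$. Below, the smallness threshold, the constant $C$ and the constants in $O(\cdot)$ may depend on everything except the amplitudes and $\varepsilon$. Then the following hold. (i) For every $n\in\mathbb Z^d$ and every real $a\neq0$ with $|a|$ small enough, $ae^{in\cdot x+i\omega_nt}$ persists with a frequency $$\omega=|n|^2+\rho+2\varsigma a^2|n|^2+O(|a|^3).$$ In each of the cases (ii)–(iv), for every small enough $\varepsilon>0$ and all $a\in[\varepsilon,2\varepsilon]^b$, the solution $u_0$ persists with a frequency $\omega=(\omega_1,\dots,\omega_b)$ such that $$\omega_j=|n_j|^2+\rho+\varsigma|n_j|^2\Big(4\sum_{l=1}^ba_l^2-2a_j^2\Big)+O(|a|^3),\qquad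 j=1,\dots,b.$$ (ii) $b=2$, and $n_1,n_2\in\mathbb Z^d$ are not parallel, i.e. are linearly independent (so $d\ge2$). (iii) $b=3$, and $n_1,n_2,n_3\in\mathbb Z^d$ are linearly independent (so $d\ge3$), and the angle between $n_i-n_j$ and $n_i-n_l$ is less than $\pi/2$ for every permutation $(i,j,l)$ of $(1,2,3)$. (iv) $b\ge1$, and $n_1,\dots,n_b\in\mathbb Z^d$ are mutually orthogonal with $|n_1|^2=\dots=|n_b|^2=M$ for some $M>0$. -/

import Mathlib

open scoped ComplexConjugate

noncomputable section

namespace QLS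

/-- Euclidean `d`-space; functions on the torus are `2π`-periodic functions on it. -/
abbrev E (d : ℕ) : Type := EuclideanSpace ℝ (Fin d)

/-- An integer vector, viewed in Euclidean space. -/
def vec {d : ℕ} (n : Fin d → ℤ) : E d := WithLp.toLp 2 (fun i => (n i : ℝ))

/-- `|m ρ - l| ≥ γ / |m| ^ τ` for all integers `m ≠ 0` and `l`, with some `γ > 0`, `τ > 1`. -/
def Diophantine (ρ : ℝ) : Prop :=
  ∃ γ τ : ℝ, 0 < γ ∧ 1 < τ ∧
    ∀ m l : ℤ, m ≠ 0 → γ / |(m : ℝ)| ^ τ ≤ |(m : ℝ) * ρ - (l : ℝ)|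

/-- The series with coefficients `α l l'`, `l + l' ≥ 5`, converges absolutely on the closed
bidisc of radius `r`. -/
def ConvergesAt (α : ℕ → ℕ → ℝ) (r : ℝ) : Prop :=
  Summable (fun p : ℕ × ℕ => if 5 ≤ p.1 + p.2 then |α p.1 p.2| * r ^ (p.1 + p.2) else 0)

/-- The admissible coefficients: real (by type), symmetric, with a series analytic near `0`. -/
def Admissible (α : ℕ → ℕ → ℝ) : Prop :=
  (∀ l l', α l l' = α l' l) ∧ ∃ r : ℝ, 0 < r ∧ ConvergesAt α r

/-- `H(z, w) = z² w² + ∑_{l + l' ≥ 5} α_{l,l'} z^l w^{l'}`, so that `H(u, ū) = |u|⁴ + ⋯`. -/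
def H (α : ℕ → ℕ → ℝ) (z w : ℂ) : ℂ :=
  z ^ 2 * w ^ 2 +
    ∑' p : ℕ × ℕ, if 5 ≤ p.1 + p.2 then (α p.1 p.2 : ℂ) * z ^ p.1 * w ^ p.2 else 0

/-- `∂H/∂ū (u, ū)`: the derivative of `H` in its second variable, at `(z, conj z)`. -/
def dHbar (α : ℕ → ℕ → ℝ) (z : ℂ) : ℂ := deriv (fun w => H α z w) (conj z)

/-- `u` is a classical solution of `i u_t - Δu + ρ u - ς Δ(∂H/∂ū (u, ū)) = 0`, with values in
the domain of convergence of `H`. -/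
structure IsSolution {d : ℕ} (ς ρ : ℝ) (α : ℕ → ℕ → ℝ) (u : ℝ → E d → ℂ) : Prop where
  contDiff : ContDiff ℝ 2 (fun p : ℝ × E d => u p.1 p.2)
  small : ∃ r : ℝ, 0 < r ∧ ConvergesAt α r ∧ ∀ t x, ‖u t x‖ < r
  eqn : ∀ t x,
    Complex.I * deriv (fun t' => u t' x) t - Laplacian.laplacian (u t) x + (ρ : ℂ) * u t x
      - (ς : ℂ) * Laplacian.laplacian (fun y => dHbar α (u t y)) x = 0

/-- The weight `|(n, k)|^{2s} e^{2σ|(n, k)|}` on `ℤ^d × ℤ^b`. -/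
def weight {d b : ℕ} (σ s : ℝ) (p : (Fin d → ℤ) × (Fin b → ℤ)) : ℝ :=
  let N : ℝ := √(‖vec p.1‖ ^ 2 + ‖vec p.2‖ ^ 2)
  N ^ (2 * s) * Real.exp (2 * σ * N)

/-- `|û(n, k)|²` times the weight, with the modes `(n_j, e_j)` left out. -/
def remainderTerm {d b : ℕ} (σ s : ℝ) (n : Fin b → Fin d → ℤ)
    (c : (Fin d → ℤ) × (Fin b → ℤ) → ℂ) (p : (Fin d → ℤ) × (Fin b → ℤ)) : ℝ :=
  open Classical in
  if ∃ j, p = (n j, Pi.single j 1) then 0 else ‖c p‖ ^ 2 * weight σ s p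

/-- The frequencies `|n_j|² + ρ` of the linear equation. -/
def omega0 {d b : ℕ} (ρ : ℝ) (n : Fin b → Fin d → ℤ) : E b :=
  WithLp.toLp 2 (fun j => ‖vec (n j)‖ ^ 2 + ρ)

/-- The solution `∑_j a_j e^{i n_j·x + i(|n_j|² + ρ)t}` of the linear equation persists with
frequency `ω`: there is a solution `∑_{n,k} û(n,k) e^{i n·x + i k·ω t}` of the nonlinear equation
with `û(n_j, e_j) = a_j`, with the remaining modes of weighted size less than `|a|^{1+κ}`, and
with `|ω - ω₀| ≤ C |a|²`. -/
def Persists {d b : ℕ} (ς ρ : ℝ) (α : ℕ → ℕ → ℝ) (σ s κ C : ℝ)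
    (n : Fin b → Fin d → ℤ) (a ω : E b) : Prop :=
  ∃ (u : ℝ → E d → ℂ) (c : (Fin d → ℤ) × (Fin b → ℤ) → ℂ),
    IsSolution ς ρ α u ∧
    (∀ t x, HasSum (fun p : (Fin d → ℤ) × (Fin b → ℤ) =>
      c p * Complex.exp (Complex.I * ((inner ℝ (vec p.1) x + inner ℝ (vec p.2) ω * t : ℝ) : ℂ)))
      (u t x)) ∧
    (∀ j, c (n j, Pi.single j 1) = (a j : ℂ)) ∧
    Summable (remainderTerm σ s n c) ∧
    √(∑' p, remainderTerm σ s n c p) < ‖a‖ ^ (1 + κ) ∧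
    ‖ω - omega0 ρ n‖ ≤ C * ‖a‖ ^ 2

/-- For all small `ε > 0` and all `a ∈ [ε, 2ε]^b` the solution of the linear equation with modes
`n_j` and amplitudes `a_j` persists, with frequency
`ω_j = |n_j|² + ρ + ς |n_j|² (4 ∑_l a_l² - 2 a_j²) + O(|a|³)`. -/
def PersistsForSmallAmplitudes {d b : ℕ} (ς ρ : ℝ) (α : ℕ → ℕ → ℝ)
    (n : Fin b → Fin d → ℤ) : Prop :=
  ∀ σ s κ : ℝ, 0 < σ → (b : ℝ) / 2 < s → 0 < κ → κ < 2 →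
    ∃ ε₀ C : ℝ, 0 < ε₀ ∧ ∀ ε : ℝ, 0 < ε → ε < ε₀ →
      ∀ a : E b, (∀ j, a j ∈ Set.Icc ε (2 * ε)) →
        ∃ ω : E b, Persists ς ρ α σ s κ C n a ω ∧
          ∀ j, |ω j - (‖vec (n j)‖ ^ 2 + ρ
            + ς * (‖vec (n j)‖ ^ 2 * (4 * (∑ l, a l ^ 2) - 2 * a j ^ 2)))| ≤ C * ‖a‖ ^ 3

end QLS

end

open scoped NNReal

/-! Solutions are sought with Fourier support on the graph of `mode n k = ∑ k_j n_j`. There,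
multiplying waves adds the indices `k ∈ ℤ^b`, and since `H` has real coefficients one may take real
Fourier coefficients `c`. The equation becomes `divisor k * c k + ς |mode n k|² * N(c) k = 0`, where
`divisor k = |mode n k|² + ρ - k·ω` and `N(c)` represents `∂H/∂ū`.

There are no small divisors. For linearly independent modes `|mode n k|²` is comparable with `|k|²`
and beats the linear term `k·ω`, so the divisor grows quadratically, just enough to absorb the two
derivatives on the nonlinearity. For the finitely many remaining `k`, the irrationality of `ρ` and
the absence of resonances (`Nonresonant`) keep the divisor away from zero unless `k = e_j`
(`exists_le_abs_divisor`). Thus `-ς |mode n k|² / divisor k` is a bounded multiplier, Lipschitz in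
`ω` (`exists_multiplier_bound`), and a plain contraction suffices.

This is a Lyapunov–Schmidt reduction. At `k = e_j` the coefficient `a_j` is prescribed and the
equation determines `ω_j`; at the other `k` it determines the correction `v`. The pair `(v, ω)` is a
fixed point of a contraction in an exponentially weighted `ℓ¹` algebra
(`exists_lyapunovSchmidt_solution`). As `N` is cubic to leading order, `v = O(ε³)`, and the
coefficient of `2|u|²u` at `e_j` gives the frequency (`coeff_cubic_lead`).

The geometry enters through `Nonresonant`. If `∑ k_j = 1`, then `|∑ k_j n_j|² - ∑ k_j |n_j|² =
-∑_{i<j} k_i k_j |n_i - n_j|²`. In cases (ii)–(iv) this is a combination, with positive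
coefficients, of the nonnegative integers `k_i (k_i - 1)`; if it vanishes, `k` is a unit vector. The
mode `n = 0` in (i) has an explicit solution. -/

noncomputable section

namespace QLS

/-! ### The weighted Wiener algebra of Fourier coefficients. -/

/-- The weighted space `ℓ¹(G, e^{μ‖k‖})` of real sequences; the underlying element of `ℓ¹` is the
sequence of coefficients multiplied by the weight. -/
def Wiener (G : Type) [SeminormedAddCommGroup G] (_μ : ℝ≥0) : Type :=
  lp (fun _ : G => ℝ) 1

namespace Wiener

variable {G : Type} [SeminormedAddCommGroup G] {μ : ℝ≥0}
variable {F : Type*} [NormedAddCommGroup F] [NormedSpace ℝ F]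

instance : NormedAddCommGroup (Wiener G μ) :=
  inferInstanceAs (NormedAddCommGroup (lp (fun _ : G => ℝ) 1))

instance : NormedSpace ℝ (Wiener G μ) :=
  inferInstanceAs (NormedSpace ℝ (lp (fun _ : G => ℝ) 1))

instance : CompleteSpace (Wiener G μ) :=
  inferInstanceAs (CompleteSpace (lp (fun _ : G => ℝ) 1))

/-- The exponential weight. -/
def wt (μ : ℝ≥0) (k : G) : ℝ := Real.exp (μ * ‖k‖)

lemma wt_pos (k : G) : 0 < wt μ k := Real.exp_pos _

lemma one_le_wt (k : G) : 1 ≤ wt μ k := Real.one_le_exp (by positivity)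

@[simp] lemma wt_neg (k : G) : wt μ (-k) = wt μ k := by simp [wt]

@[simp] lemma wt_zero : wt μ (0 : G) = 1 := by simp [wt]

lemma wt_add_le (k l : G) : wt μ (k + l) ≤ wt μ k * wt μ l := by
  rw [wt, wt, wt, ← Real.exp_add, ← mul_add]
  gcongr
  exact norm_add_le k l

/-- The coefficient at `k`. -/
def coeff (c : Wiener G μ) (k : G) : ℝ := (show lp (fun _ : G => ℝ) 1 from c) k / wt μ k

@[simp] lemma coeff_zero (k : G) : coeff (0 : Wiener G μ) k = 0 := by
  change (0 : ℝ) / _ = 0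
  simp

@[simp] lemma coeff_add (c d : Wiener G μ) (k : G) : coeff (c + d) k = coeff c k + coeff d k :=
  add_div _ _ _

@[simp] lemma coeff_smul (r : ℝ) (c : Wiener G μ) (k : G) : coeff (r • c) k = r * coeff c k :=
  mul_div_assoc _ _ _

lemma hasSum_norm (c : Wiener G μ) : HasSum (fun k => |coeff c k| * wt μ k) ‖c‖ := by
  have h := lp.hasSum_norm (p := 1) (by simp) (show lp (fun _ : G => ℝ) 1 from c)
  simp only [ENNReal.toReal_one, Real.rpow_one] at h
  convert! h using 2 with k
  rw [coeff, abs_div, abs_of_pos (wt_pos k), div_mul_cancel₀ _ (wt_pos k).ne', Real.norm_eq_abs]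

lemma abs_coeff_mul_wt_le (c : Wiener G μ) (k : G) : |coeff c k| * wt μ k ≤ ‖c‖ :=
  le_hasSum (hasSum_norm c) k fun _ _ => mul_nonneg (abs_nonneg _) (wt_pos _).le

lemma abs_coeff_le (c : Wiener G μ) (k : G) : |coeff c k| ≤ ‖c‖ :=
  (le_mul_of_one_le_right (abs_nonneg _) (one_le_wt k)).trans (abs_coeff_mul_wt_le c k)

open Classical in
/-- The monomial with coefficient `1` at `k`. -/
def X (k : G) : Wiener G μ := (lp.single 1 k (wt μ k) : lp (fun _ : G => ℝ) 1)

open Classical in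
lemma coeff_X (k l : G) : coeff (X k : Wiener G μ) l = if l = k then 1 else 0 := by
  change (Pi.single k (wt μ k) : G → ℝ) l / wt μ l = _
  split_ifs with h
  · subst h
    simp [(wt_pos l).ne']
  · simp [h]

lemma norm_X (k : G) : ‖(X k : Wiener G μ)‖ = wt μ k := by
  classical
  refine (hasSum_norm (X k : Wiener G μ)).unique ?_
  convert! hasSum_ite_eq k (wt μ k) using 2 with l
  rw [coeff_X]
  split_ifs with h <;> simp [h]

lemma hasSum_coeff_smul_X (c : Wiener G μ) : HasSum (fun k => coeff c k • (X k : Wiener G μ)) c := by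
  classical
  have h := lp.hasSum_single (p := 1) (by simp) (show lp (fun _ : G => ℝ) 1 from c)
  refine h.congr_fun fun k => ?_
  change coeff c k • (lp.single 1 k (wt μ k) : lp (fun _ : G => ℝ) 1) = _
  rw [← lp.single_smul, smul_eq_mul, coeff, div_mul_cancel₀ _ (wt_pos k).ne']

@[ext] lemma ext {c d : Wiener G μ} (h : ∀ k, coeff c k = coeff d k) : c = d :=
  (hasSum_coeff_smul_X c).unique (by simpa only [h] using hasSum_coeff_smul_X d)

/-- The monomials span a dense subspace. The algebraic identities below are all reduced to monomials
in this way, one variable at a time. -/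
lemma clm_ext {f g : Wiener G μ →L[ℝ] F} (h : ∀ k, f (X k) = g (X k)) : f = g := by
  ext c
  have hf := (hasSum_coeff_smul_X c).mapL f
  have hg := (hasSum_coeff_smul_X c).mapL g
  simp only [map_smul, h] at hf hg
  exact hf.unique hg

section lift

lemma summable_norm_coeff_smul {f : G → F} {M : ℝ} (hf : ∀ k, ‖f k‖ ≤ M * wt μ k)
    (c : Wiener G μ) : Summable fun k => ‖coeff c k • f k‖ := by
  refine Summable.of_nonneg_of_le (fun _ => norm_nonneg _) (fun k => ?_)
    ((hasSum_norm c).summable.mul_left M)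
  rw [norm_smul, Real.norm_eq_abs]
  calc |coeff c k| * ‖f k‖ ≤ |coeff c k| * (M * wt μ k) := by gcongr; exact hf k
    _ = _ := by ring

variable [CompleteSpace F]

/-- The bounded linear map that sends `X k` to `f k`. -/
def lift (f : G → F) (M : ℝ) (hf : ∀ k, ‖f k‖ ≤ M * wt μ k) : Wiener G μ →L[ℝ] F :=
  LinearMap.mkContinuous
    { toFun := fun c => ∑' k, coeff c k • f k
      map_add' := fun c d => by
        simp only [coeff_add, add_smul]
        exact (summable_norm_coeff_smul hf c).of_norm.tsum_add
          (summable_norm_coeff_smul hf d).of_norm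
      map_smul' := fun r c => by
        simp only [coeff_smul, mul_smul, RingHom.id_apply]
        exact (summable_norm_coeff_smul hf c).of_norm.tsum_const_smul r } M (fun c => by
      refine tsum_of_norm_bounded ((hasSum_norm c).mul_left M) fun k => ?_
      rw [norm_smul, Real.norm_eq_abs]
      calc |coeff c k| * ‖f k‖ ≤ |coeff c k| * (M * wt μ k) := by gcongr; exact hf k
        _ = _ := by ring)

lemma hasSum_lift {f : G → F} {M : ℝ} (hf : ∀ k, ‖f k‖ ≤ M * wt μ k) (c : Wiener G μ) :
    HasSum (fun k => coeff c k • f k) (lift f M hf c) :=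
  (summable_norm_coeff_smul hf c).of_norm.hasSum

@[simp] lemma lift_X {f : G → F} {M : ℝ} (hf : ∀ k, ‖f k‖ ≤ M * wt μ k) (k : G) :
    lift f M hf (X k) = f k := by
  classical
  refine (hasSum_lift hf (X k)).unique ?_
  convert! hasSum_ite_eq k (f k) using 2 with l
  rw [coeff_X]
  split_ifs with h <;> simp [h]

lemma norm_lift_apply_le {f : G → F} {M : ℝ} (hM : 0 ≤ M) (hf : ∀ k, ‖f k‖ ≤ M * wt μ k)
    (c : Wiener G μ) : ‖lift f M hf c‖ ≤ M * ‖c‖ :=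
  (LinearMap.mkContinuous_norm_le _ hM _ : ‖lift f M hf‖ ≤ M) |> (lift f M hf).le_of_opNorm_le <| c

end lift

/-- Multiplication by `X k`. -/
def shift (k : G) : Wiener G μ →L[ℝ] Wiener G μ :=
  lift (fun l => X (k + l)) (wt μ k) fun l => by rw [norm_X]; exact wt_add_le k l

lemma norm_shift_le (k : G) : ‖(shift k : Wiener G μ →L[ℝ] Wiener G μ)‖ ≤ 1 * wt μ k :=
  ContinuousLinearMap.opNorm_le_bound _ (by linarith [wt_pos (μ := μ) k]) fun c => by
    rw [one_mul]; exact norm_lift_apply_le (wt_pos k).le _ c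

/-- Convolution, as a bounded bilinear map. -/
def mulL : Wiener G μ →L[ℝ] Wiener G μ →L[ℝ] Wiener G μ := lift shift 1 norm_shift_le

@[simp] lemma mulL_X_X (k l : G) : mulL (X k : Wiener G μ) (X l) = X (k + l) := by
  simp [mulL, shift]

lemma mulL_comm (c d : Wiener G μ) : mulL c d = mulL d c := by
  have : (mulL : Wiener G μ →L[ℝ] _) = mulL.flip :=
    clm_ext fun k => clm_ext fun l => by simp [add_comm]
  conv_lhs => rw [this]
  rfl

lemma mulL_assoc (c d e : Wiener G μ) : mulL (mulL c d) e = mulL c (mulL d e) := by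
  have h1 : ∀ (k l : G) (e : Wiener G μ), mulL (mulL (X k) (X l)) e = mulL (X k) (mulL (X l) e) := by
    intro k l e
    have : mulL (mulL (X k : Wiener G μ) (X l)) = (mulL (X k)).comp (mulL (X l)) :=
      clm_ext fun m => by simp [add_assoc]
    exact congrArg (· e) this
  have h2 : ∀ (k : G) (d e : Wiener G μ), mulL (mulL (X k) d) e = mulL (X k) (mulL d e) := by
    intro k d e
    have : (mulL.flip e).comp (mulL (X k : Wiener G μ)) = (mulL (X k)).comp (mulL.flip e) :=
      clm_ext fun l => by simpa using h1 k l e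
    exact congrArg (· d) this
  have : (mulL.flip e).comp (mulL.flip d) = mulL.flip (mulL d e) :=
    clm_ext fun k => by simpa using h2 k d e
  exact congrArg (· c) this

lemma mulL_X_zero (c : Wiener G μ) : mulL (X 0) c = c := by
  have : mulL (X 0 : Wiener G μ) = ContinuousLinearMap.id ℝ _ := clm_ext fun k => by simp
  exact congrArg (· c) this

lemma norm_mulL_le (c d : Wiener G μ) : ‖mulL c d‖ ≤ ‖c‖ * ‖d‖ := by
  refine ((mulL c).le_opNorm d).trans ?_
  gcongr
  exact (norm_lift_apply_le zero_le_one norm_shift_le c).trans_eq (one_mul _)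

instance : NormedCommRing (Wiener G μ) :=
  { (inferInstance : NormedAddCommGroup (Wiener G μ)) with
    mul := fun c d => mulL c d
    one := X 0
    left_distrib := fun c d e => (mulL c).map_add d e
    right_distrib := fun c d e => by
      change mulL (c + d) e = mulL c e + mulL d e
      simp
    zero_mul := fun c => by
      change mulL 0 c = 0
      simp
    mul_zero := fun c => (mulL c).map_zero
    mul_assoc := mulL_assoc
    one_mul := mulL_X_zero
    mul_one := fun c => (mulL_comm c (X 0)).trans (mulL_X_zero c)
    mul_comm := mulL_comm
    norm_mul_le := norm_mulL_le }

lemma one_def : (1 : Wiener G μ) = X 0 := rfl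

@[simp] lemma X_mul_X (k l : G) : (X k * X l : Wiener G μ) = X (k + l) := mulL_X_X k l

instance : NormOneClass (Wiener G μ) := ⟨by rw [one_def, norm_X, wt_zero]⟩

instance : IsScalarTower ℝ (Wiener G μ) (Wiener G μ) :=
  ⟨fun r c d => by
    change mulL (r • c) d = r • mulL c d
    simp⟩

instance : SMulCommClass ℝ (Wiener G μ) (Wiener G μ) :=
  ⟨fun r c d => by
    change r • mulL c d = mulL c (r • d)
    simp⟩

/-- The reflection `k ↦ -k` of the coefficients: conjugation on the Fourier side. -/
def bar : Wiener G μ →L[ℝ] Wiener G μ :=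
  lift (fun k => X (-k)) 1 fun k => by rw [norm_X, wt_neg, one_mul]

@[simp] lemma bar_X (k : G) : bar (X k : Wiener G μ) = X (-k) := lift_X _ k

lemma norm_bar_le (c : Wiener G μ) : ‖bar c‖ ≤ ‖c‖ :=
  (norm_lift_apply_le zero_le_one _ c).trans_eq (one_mul _)

/-- Diagonal operators. -/
def diag (m : G → ℝ) (M : ℝ) (hm : ∀ k, |m k| ≤ M) : Wiener G μ →L[ℝ] Wiener G μ :=
  lift (fun k => m k • X k) M fun k => by
    rw [norm_smul, norm_X, Real.norm_eq_abs]
    have := wt_pos (μ := μ) k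
    gcongr
    exact hm k

/-- The coefficient at `k` as a bounded linear functional. -/
def coeffL (k : G) : Wiener G μ →L[ℝ] ℝ :=
  LinearMap.mkContinuous
    { toFun := fun c => coeff c k
      map_add' := fun c d => coeff_add c d k
      map_smul' := fun r c => coeff_smul r c k } 1 (fun c => by
        simpa using abs_coeff_le c k)

@[simp] lemma coeffL_apply (k : G) (c : Wiener G μ) : coeffL k c = coeff c k := rfl

lemma coeff_sum {ι : Type*} (s : Finset ι) (f : ι → Wiener G μ) (k : G) :
    coeff (∑ i ∈ s, f i) k = ∑ i ∈ s, coeff (f i) k := map_sum (coeffL k) f s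

@[simp] lemma coeff_sub (c d : Wiener G μ) (k : G) : coeff (c - d) k = coeff c k - coeff d k :=
  map_sub (coeffL k) c d

lemma coeff_diag (m : G → ℝ) (M : ℝ) (hm : ∀ k, |m k| ≤ M) (c : Wiener G μ) (k : G) :
    coeff (diag m M hm c) k = m k * coeff c k := by
  classical
  have : (coeffL k).comp (diag m M hm) = m k • (coeffL k : Wiener G μ →L[ℝ] ℝ) :=
    clm_ext fun l => by
      simp only [diag, ContinuousLinearMap.comp_apply, lift_X, coeffL_apply, coeff_smul,
        smul_apply, coeff_X, smul_eq_mul]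
      split_ifs with h <;> simp [h]
  exact congrArg (· c) this

lemma norm_diag_apply_le (m : G → ℝ) (M : ℝ) (hM : 0 ≤ M) (hm : ∀ k, |m k| ≤ M)
    (c : Wiener G μ) : ‖diag m M hm c‖ ≤ M * ‖c‖ := norm_lift_apply_le hM _ c

/-- Evaluation at a unitary character. -/
def eval (χ : G → ℂ) (hχ : ∀ k, ‖χ k‖ = 1) : Wiener G μ →L[ℝ] ℂ :=
  lift χ 1 fun k => by rw [hχ, one_mul]; exact one_le_wt k

lemma hasSum_eval (χ : G → ℂ) (hχ : ∀ k, ‖χ k‖ = 1) (c : Wiener G μ) :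
    HasSum (fun k => (coeff c k : ℂ) * χ k) (eval χ hχ c) := by
  exact (hasSum_lift _ c).congr_fun fun k => (Complex.real_smul).symm

lemma norm_eval_le (χ : G → ℂ) (hχ : ∀ k, ‖χ k‖ = 1) (c : Wiener G μ) : ‖eval χ hχ c‖ ≤ ‖c‖ :=
  (norm_lift_apply_le zero_le_one _ c).trans_eq (one_mul _)

section character

variable {χ : G → ℂ} (hχ : ∀ k, ‖χ k‖ = 1)

lemma eval_mul (hadd : ∀ k l, χ (k + l) = χ k * χ l) (c d : Wiener G μ) :
    eval χ hχ (c * d) = eval χ hχ c * eval χ hχ d := by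
  have : (ContinuousLinearMap.compL ℝ _ _ _ (eval χ hχ)).comp mulL =
      ((ContinuousLinearMap.mul ℝ ℂ).bilinearComp (eval χ hχ) (eval χ hχ) :
        Wiener G μ →L[ℝ] Wiener G μ →L[ℝ] ℂ) :=
    clm_ext fun k => clm_ext fun l => by simp [eval, hadd]
  exact congrArg (fun f => f c d) this

lemma eval_one (hadd : ∀ k l, χ (k + l) = χ k * χ l) : eval χ hχ (1 : Wiener G μ) = 1 := by
  have h : χ 0 = χ 0 * χ 0 := by simpa using hadd 0 0
  have h0 : χ 0 ≠ 0 := by rw [← norm_ne_zero_iff, hχ]; exact one_ne_zero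
  rw [one_def, eval, lift_X]
  exact (mul_eq_left₀ h0).1 h.symm

lemma eval_pow (hadd : ∀ k l, χ (k + l) = χ k * χ l) (c : Wiener G μ) (m : ℕ) :
    eval χ hχ (c ^ m) = eval χ hχ c ^ m := by
  induction m with
  | zero => rw [pow_zero, pow_zero, eval_one hχ hadd]
  | succ m ih => rw [pow_succ, pow_succ, eval_mul hχ hadd, ih]

lemma eval_bar (hneg : ∀ k, χ (-k) = conj (χ k)) (c : Wiener G μ) :
    eval χ hχ (bar c) = conj (eval χ hχ c) := by
  have : (eval χ hχ).comp bar =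
      (Complex.conjCLE : ℂ →L[ℝ] ℂ).comp (eval χ hχ : Wiener G μ →L[ℝ] ℂ) :=
    clm_ext fun k => by simp [eval, hneg]
  exact congrArg (· c) this

end character

end Wiener

/-! ### The nonlinear term on the Wiener algebra. -/

section Nonlinearity

section powers

variable {R : Type*} [NormedCommRing R] [NormOneClass R]

/-- The extra factor `η` on the left avoids the exponent `l - 1`, so that `l = 0` needs no separate
form. -/
lemma norm_pow_sub_pow_mul_le {c c' : R} {η δ : ℝ} (hc : ‖c‖ ≤ η) (hc' : ‖c'‖ ≤ η)
    (h : ‖c - c'‖ ≤ δ) (l : ℕ) : ‖c ^ l - c' ^ l‖ * η ≤ l * η ^ l * δ := by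
  have hη : 0 ≤ η := (norm_nonneg c).trans hc
  induction l with
  | zero => simp
  | succ l ih =>
    have e : c ^ (l + 1) - c' ^ (l + 1) = c ^ l * (c - c') + (c ^ l - c' ^ l) * c' := by ring
    have h1 : ‖c ^ l * (c - c')‖ ≤ η ^ l * δ :=
      (norm_mul_le _ _).trans (mul_le_mul ((norm_pow_le _ _).trans (by gcongr)) h
        (norm_nonneg _) (by positivity))
    have h2 : ‖(c ^ l - c' ^ l) * c'‖ ≤ ‖c ^ l - c' ^ l‖ * η :=
      (norm_mul_le _ _).trans (by gcongr)
    calc ‖c ^ (l + 1) - c' ^ (l + 1)‖ * η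
        ≤ (η ^ l * δ + l * η ^ l * δ) * η := by
          rw [e]
          gcongr
          exact (norm_add_le _ _).trans (add_le_add h1 (h2.trans ih))
      _ = _ := by push_cast; ring

lemma norm_pow_mul_pow_sub_le {c c' d d' : R} {η δ : ℝ} (hc : ‖c‖ ≤ η) (hc' : ‖c'‖ ≤ η)
    (hd : ‖d‖ ≤ η) (hd' : ‖d'‖ ≤ η) (h : ‖c - c'‖ ≤ δ) (h' : ‖d - d'‖ ≤ δ) (l m : ℕ) :
    ‖c ^ l * d ^ m - c' ^ l * d' ^ m‖ * η ≤ (l + m) * η ^ (l + m) * δ := by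
  have hη : 0 ≤ η := (norm_nonneg c).trans hc
  have e : c ^ l * d ^ m - c' ^ l * d' ^ m = c ^ l * (d ^ m - d' ^ m) + (c ^ l - c' ^ l) * d' ^ m := by
    ring
  have h1 : ‖c ^ l * (d ^ m - d' ^ m)‖ ≤ η ^ l * ‖d ^ m - d' ^ m‖ :=
    (norm_mul_le _ _).trans (by gcongr; exact (norm_pow_le _ _).trans (by gcongr))
  have h2 : ‖(c ^ l - c' ^ l) * d' ^ m‖ ≤ ‖c ^ l - c' ^ l‖ * η ^ m :=
    (norm_mul_le _ _).trans (by gcongr; exact (norm_pow_le _ _).trans (by gcongr))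
  calc ‖c ^ l * d ^ m - c' ^ l * d' ^ m‖ * η
      ≤ (η ^ l * ‖d ^ m - d' ^ m‖ + ‖c ^ l - c' ^ l‖ * η ^ m) * η := by
        rw [e]
        gcongr
        exact (norm_add_le _ _).trans (add_le_add h1 h2)
    _ = η ^ l * (‖d ^ m - d' ^ m‖ * η) + ‖c ^ l - c' ^ l‖ * η * η ^ m := by ring
    _ ≤ η ^ l * (m * η ^ m * δ) + l * η ^ l * δ * η ^ m := by
        refine add_le_add (mul_le_mul_of_nonneg_left ?_ (by positivity))
          (mul_le_mul_of_nonneg_right ?_ (by positivity))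
        · exact norm_pow_sub_pow_mul_le hd hd' h' m
        · exact norm_pow_sub_pow_mul_le hc hc' h l
    _ = _ := by ring

end powers

open Wiener

/-- The majorant of the terms of `H` of degree at least five. -/
def majorant (α : ℕ → ℕ → ℝ) (r : ℝ) (p : ℕ × ℕ) : ℝ :=
  if 5 ≤ p.1 + p.2 then |α p.1 p.2| * r ^ (p.1 + p.2) else 0

/-- The coefficients of `∂H/∂ū`, without the cubic term. -/
def dcoef (α : ℕ → ℕ → ℝ) (p : ℕ × ℕ) : ℝ :=
  if 5 ≤ p.1 + p.2 then α p.1 p.2 * p.2 else 0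

lemma majorant_nonneg {α : ℕ → ℕ → ℝ} {r : ℝ} (hr : 0 < r) (p : ℕ × ℕ) : 0 ≤ majorant α r p := by
  rw [majorant]; split_ifs <;> positivity

/-- Differentiating in `ū` and then taking a Lipschitz constant costs two factors linear in the
degree, each at most `2 ^ degree`. Shrinking the radius from `r` to `r / 4` pays for both, and
degree at least five leaves `η ^ 4`. -/
lemma abs_dcoef_mul_le {α : ℕ → ℕ → ℝ} {r η : ℝ} (hr : 0 < r) (hη : 0 < η) (hηr : η ≤ r / 4)
    (p : ℕ × ℕ) : |dcoef α p| * ((p.1 + (p.2 - 1 : ℕ) : ℝ) * η ^ (p.1 + (p.2 - 1))) ≤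
      majorant α r p / (r / 4) ^ 5 * η ^ 4 := by
  obtain ⟨l, m⟩ := p
  rw [dcoef, majorant]
  dsimp only
  split_ifs with h
  swap
  · simp
  -- Terms free of `ū` have coefficient zero, so the truncated exponent `0 - 1` does no harm.
  rcases m with _ | m
  · simp only [Nat.cast_zero, mul_zero, abs_zero, zero_mul]
    positivity
  obtain ⟨q, hq⟩ := Nat.exists_eq_add_of_le (show 4 ≤ l + m by omega)
  have e1 : l + (m + 1) = q + 5 := by omega
  have e3 : (l : ℝ) + m = q + 4 := by exact_mod_cast (by omega : l + m = q + 4)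
  have hm : (m : ℝ) + 1 ≤ q + 5 := by exact_mod_cast (by omega : m + 1 ≤ q + 5)
  have h2 : (q : ℝ) + 5 ≤ 2 ^ (q + 5) := by
    exact_mod_cast (Nat.lt_two_pow_self (n := q + 5)).le
  have h4 : ((m : ℝ) + 1) * (q + 4) ≤ 4 ^ (q + 5) := by
    calc ((m : ℝ) + 1) * (q + 4) ≤ 2 ^ (q + 5) * 2 ^ (q + 5) := by
          gcongr <;> linarith
      _ = 4 ^ (q + 5) := by rw [← mul_pow]; norm_num
  rw [e1, abs_mul, Nat.add_sub_cancel, e3, hq]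
  push_cast
  rw [abs_of_nonneg (by positivity : (0 : ℝ) ≤ (m : ℝ) + 1)]
  calc |α l (m + 1)| * ((m : ℝ) + 1) * ((q + 4) * η ^ (4 + q))
      = |α l (m + 1)| * (((m : ℝ) + 1) * (q + 4)) * η ^ q * η ^ 4 := by ring
    _ ≤ |α l (m + 1)| * 4 ^ (q + 5) * (r / 4) ^ q * η ^ 4 := by gcongr
    _ = |α l (m + 1)| * r ^ (q + 5) / (r / 4) ^ 5 * η ^ 4 := by
        rw [div_pow, div_pow]
        field_simp
        ring

variable {G : Type} [SeminormedAddCommGroup G] {μ : ℝ≥0}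

/-- The part of `∂H/∂ū` of degree at least four, on the Wiener algebra. -/
def hot (α : ℕ → ℕ → ℝ) (c : Wiener G μ) : Wiener G μ :=
  ∑' p : ℕ × ℕ, dcoef α p • (c ^ p.1 * bar c ^ (p.2 - 1))

/-- `∂H/∂ū` on the Wiener algebra. -/
def nonlin (α : ℕ → ℕ → ℝ) (c : Wiener G μ) : Wiener G μ :=
  (2 : ℝ) • (c ^ 2 * bar c ^ 1) + hot α c

section estimates

variable {α : ℕ → ℕ → ℝ} {r : ℝ}

lemma norm_hot_term_sub_le (hr : 0 < r) {η : ℝ} (hη : 0 < η)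
    (hηr : η ≤ r / 4) {c c' : Wiener G μ} (hc : ‖c‖ ≤ η) (hc' : ‖c'‖ ≤ η) (p : ℕ × ℕ) :
    ‖dcoef α p • (c ^ p.1 * bar c ^ (p.2 - 1)) - dcoef α p • (c' ^ p.1 * bar c' ^ (p.2 - 1))‖ ≤
      majorant α r p * ((r / 4) ^ 5)⁻¹ * (η ^ 3 * ‖c - c'‖) := by
  have h1 := norm_pow_mul_pow_sub_le hc hc' ((norm_bar_le c).trans hc) ((norm_bar_le c').trans hc')
    le_rfl (by rw [← map_sub]; exact norm_bar_le _) p.1 (p.2 - 1)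
  have h2 := abs_dcoef_mul_le (α := α) hr hη hηr p
  rw [← smul_sub, norm_smul, Real.norm_eq_abs]
  refine le_of_mul_le_mul_right ?_ hη
  calc _ = |dcoef α p| * (‖c ^ p.1 * bar c ^ (p.2 - 1) - c' ^ p.1 * bar c' ^ (p.2 - 1)‖ * η) := by
        ring
    _ ≤ |dcoef α p| * ((p.1 + (p.2 - 1 : ℕ) : ℝ) * η ^ (p.1 + (p.2 - 1)) * ‖c - c'‖) := by gcongr
    _ = |dcoef α p| * ((p.1 + (p.2 - 1 : ℕ) : ℝ) * η ^ (p.1 + (p.2 - 1))) * ‖c - c'‖ := by ring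
    _ ≤ majorant α r p / (r / 4) ^ 5 * η ^ 4 * ‖c - c'‖ := by gcongr
    _ = _ := by ring

lemma hot_term_zero (p : ℕ × ℕ) :
    dcoef α p • ((0 : Wiener G μ) ^ p.1 * bar (0 : Wiener G μ) ^ (p.2 - 1)) = 0 := by
  rw [map_zero, ← pow_add, dcoef]
  split_ifs with h
  · rcases Nat.eq_zero_or_pos p.2 with h2 | h2
    · simp [h2]
    · rw [zero_pow (by omega), smul_zero]
  · rw [zero_smul]

lemma summable_hot (hr : 0 < r) (hα : ConvergesAt α r) {c : Wiener G μ} (hc : ‖c‖ ≤ r / 4) :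
    Summable fun p : ℕ × ℕ => dcoef α p • (c ^ p.1 * bar c ^ (p.2 - 1)) := by
  have hm : Summable (majorant α r) := hα
  refine Summable.of_norm_bounded ((hm.mul_right ((r / 4) ^ 5)⁻¹).mul_right
    ((r / 4) ^ 3 * ‖c - 0‖)) fun p => ?_
  have := norm_hot_term_sub_le (α := α) hr (by positivity) le_rfl hc
    (c' := 0) (by rw [norm_zero]; positivity) p
  rwa [hot_term_zero, sub_zero] at this

lemma norm_hot_sub_le (hr : 0 < r) (hα : ConvergesAt α r) {η : ℝ} (hη : 0 < η)
    (hηr : η ≤ r / 4) {c c' : Wiener G μ} (hc : ‖c‖ ≤ η) (hc' : ‖c'‖ ≤ η) :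
    ‖hot α c - hot α c'‖ ≤
      (∑' p, majorant α r p) * ((r / 4) ^ 5)⁻¹ * (η ^ 3 * ‖c - c'‖) := by
  have hm : Summable (majorant α r) := hα
  rw [hot, hot, ← (summable_hot hr hα (hc.trans hηr)).tsum_sub (summable_hot hr hα (hc'.trans hηr))]
  exact tsum_of_norm_bounded ((hm.hasSum.mul_right _).mul_right _)
    (norm_hot_term_sub_le hr hη hηr hc hc')

lemma hot_zero : hot α (0 : Wiener G μ) = 0 := by
  simp only [hot, hot_term_zero, tsum_zero]

/-- Termwise differentiation on the disc of radius `r / 2`: the factor `m` from the derivative is at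
most `2 ^ (l + m)`, which the passage from `r` to `r / 2` absorbs. -/
lemma hasDerivAt_H (hr : 0 < r) (hα : ConvergesAt α r) {z w : ℂ} (hz : ‖z‖ ≤ r / 4)
    (hw : ‖w‖ ≤ r / 4) : HasDerivAt (fun w => H α z w)
      (2 * z ^ 2 * w + ∑' p : ℕ × ℕ, (dcoef α p : ℂ) * (z ^ p.1 * w ^ (p.2 - 1))) w := by
  have hm : Summable (majorant α r) := hα
  unfold H
  have h1 : HasDerivAt (fun w : ℂ => z ^ 2 * w ^ 2) (2 * z ^ 2 * w) w := by
    convert! ((hasDerivAt_pow 2 w).const_mul (z ^ 2)) using 1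
    push_cast
    ring
  refine h1.add ?_
  refine hasDerivAt_tsum_of_isPreconnected (u := fun p => majorant α r p * (2 / r))
    (t := Metric.ball 0 (r / 2)) (y₀ := 0)
    (g := fun (p : ℕ × ℕ) w => if 5 ≤ p.1 + p.2 then (α p.1 p.2 : ℂ) * z ^ p.1 * w ^ p.2 else 0)
    (g' := fun (p : ℕ × ℕ) w => (dcoef α p : ℂ) * (z ^ p.1 * w ^ (p.2 - 1)))
    (hm.mul_right _) Metric.isOpen_ball (convex_ball _ _).isPreconnected ?_ ?_ ?_ ?_ ?_
  · intro p w _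
    dsimp only [dcoef]
    split_ifs with h
    · convert! ((hasDerivAt_pow p.2 w).const_mul ((α p.1 p.2 : ℂ) * z ^ p.1)) using 1
      push_cast
      ring
    · simpa using! hasDerivAt_const w (0 : ℂ)
  · rintro ⟨l, m⟩ w hw
    rw [mem_ball_zero_iff] at hw
    dsimp only [dcoef, majorant]
    split_ifs with h
    swap
    · simp
    rcases m with _ | m
    · simp only [Nat.cast_zero, mul_zero, Complex.ofReal_zero, zero_mul, norm_zero]
      positivity
    rw [norm_mul, norm_mul, norm_pow, norm_pow, Complex.norm_real, Real.norm_eq_abs, abs_mul,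
      Nat.add_sub_cancel, Nat.abs_cast]
    have h2 : ((m + 1 : ℕ) : ℝ) ≤ 2 ^ (l + (m + 1)) := by
      calc ((m + 1 : ℕ) : ℝ) ≤ ((l + (m + 1) : ℕ) : ℝ) := by exact_mod_cast Nat.le_add_left _ _
        _ ≤ 2 ^ (l + (m + 1)) := by exact_mod_cast (Nat.lt_two_pow_self (n := l + (m + 1))).le
    calc |α l (m + 1)| * ((m + 1 : ℕ) : ℝ) * (‖z‖ ^ l * ‖w‖ ^ m)
        ≤ |α l (m + 1)| * 2 ^ (l + (m + 1)) * ((r / 2) ^ l * (r / 2) ^ m) := by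
          gcongr
          linarith
      _ = |α l (m + 1)| * r ^ (l + (m + 1)) * (2 / r) := by
          rw [div_pow, div_pow]
          field_simp
          ring
  · rw [mem_ball_zero_iff, norm_zero]; positivity
  · refine Summable.of_norm_bounded hm fun p => ?_
    dsimp only [majorant]
    split_ifs with h
    · rw [norm_mul, norm_mul, norm_pow, norm_pow, Complex.norm_real, Real.norm_eq_abs, norm_zero,
        pow_add, mul_assoc]
      have : ‖z‖ ≤ r := by linarith
      gcongr
    · simp
  · rw [mem_ball_zero_iff]
    linarith

/-- Evaluation at a character is a continuous algebra homomorphism that turns `bar` into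
conjugation, so it commutes with the power series. -/
lemma eval_nonlin (hr : 0 < r) (hα : ConvergesAt α r) {χ : G → ℂ} (hχ : ∀ k, ‖χ k‖ = 1)
    (hadd : ∀ k l, χ (k + l) = χ k * χ l) (hneg : ∀ k, χ (-k) = conj (χ k)) {c : Wiener G μ}
    (hc : ‖c‖ ≤ r / 4) : eval χ hχ (nonlin α c) = dHbar α (eval χ hχ c) := by
  have hz : ‖eval χ hχ c‖ ≤ r / 4 := (norm_eval_le χ hχ c).trans hc
  rw [dHbar, (hasDerivAt_H hr hα hz (by rwa [RCLike.norm_conj])).deriv, nonlin, map_add, hot,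
    (eval χ hχ).map_tsum (summable_hot hr hα hc)]
  simp only [map_smul, eval_mul hχ hadd, eval_pow hχ hadd, eval_bar hχ hneg, Complex.real_smul]
  push_cast
  ring

lemma norm_nonlin_sub_le (hr : 0 < r) (hα : ConvergesAt α r) :
    ∃ L : ℝ, 0 < L ∧ ∀ η : ℝ, 0 < η → η ≤ r / 4 → ∀ c c' : Wiener G μ, ‖c‖ ≤ η → ‖c'‖ ≤ η →
      ‖nonlin α c - nonlin α c'‖ ≤ L * η ^ 2 * ‖c - c'‖ ∧
      ‖nonlin α c' - (2 : ℝ) • (c' ^ 2 * bar c')‖ ≤ L * η ^ 4 := by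
  set S := (∑' p, majorant α r p) * ((r / 4) ^ 5)⁻¹ with hS
  have hS0 : 0 ≤ S := mul_nonneg (tsum_nonneg (majorant_nonneg hr)) (by positivity)
  -- The cubic term contributes `6 η²` to the Lipschitz constant and the higher terms `S η³ ≤ S (r /
  -- 4) η²`; the last `S` serves the second estimate.
  refine ⟨6 + S * (r / 4) + S, by positivity, fun η hη hηr c c' hc hc' => ⟨?_, ?_⟩⟩
  · have h1 := norm_pow_mul_pow_sub_le hc hc' ((norm_bar_le c).trans hc)
      ((norm_bar_le c').trans hc') le_rfl (by rw [← map_sub]; exact norm_bar_le _) 2 1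
    have h1' : ‖c ^ 2 * bar c ^ 1 - c' ^ 2 * bar c' ^ 1‖ ≤ 3 * η ^ 2 * ‖c - c'‖ := by
      refine le_of_mul_le_mul_right (h1.trans_eq ?_) hη
      push_cast
      ring
    have h2 := norm_hot_sub_le hr hα hη hηr hc hc'
    have e : nonlin α c - nonlin α c' =
        (2 : ℝ) • (c ^ 2 * bar c ^ 1 - c' ^ 2 * bar c' ^ 1) + (hot α c - hot α c') := by
      rw [nonlin, nonlin, smul_sub]; abel
    calc ‖nonlin α c - nonlin α c'‖ ≤ 2 * (3 * η ^ 2 * ‖c - c'‖) + S * (η ^ 3 * ‖c - c'‖) := by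
          rw [e]
          refine (norm_add_le _ _).trans (add_le_add ?_ h2)
          rw [norm_smul, Real.norm_ofNat]
          gcongr
      _ = (6 + S * η) * η ^ 2 * ‖c - c'‖ := by ring
      _ ≤ (6 + S * (r / 4) + S) * η ^ 2 * ‖c - c'‖ := by
          have : S * η ≤ S * (r / 4) := by gcongr
          gcongr ?_ * _ * _
          linarith
  · have h2 := norm_hot_sub_le hr hα hη hηr hc' (c' := 0) (by rw [norm_zero]; positivity)
    rw [hot_zero, sub_zero, sub_zero] at h2
    rw [nonlin, pow_one, add_sub_cancel_left]
    calc ‖hot α c'‖ ≤ S * (η ^ 3 * ‖c'‖) := h2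
      _ ≤ S * (η ^ 3 * η) := by gcongr
      _ = S * η ^ 4 := by ring
      _ ≤ _ := by gcongr; nlinarith

lemma nonlin_zero : nonlin α (0 : Wiener G μ) = 0 := by
  simp [nonlin, hot_zero]

end estimates

end Nonlinearity

/-! ### Resonances and lower bounds for the divisors. -/

section Resonances

variable {d b : ℕ}

@[simp] lemma vec_apply (k : Fin b → ℤ) (j : Fin b) : vec k j = (k j : ℝ) := rfl

lemma norm_sq_vec (k : Fin b → ℤ) : ‖vec k‖ ^ 2 = ((∑ j, k j ^ 2 : ℤ) : ℝ) := by
  rw [EuclideanSpace.norm_sq_eq]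
  push_cast
  exact Finset.sum_congr rfl fun j _ => by rw [vec_apply, Real.norm_eq_abs, sq_abs]

lemma inner_vec (k : Fin b → ℤ) (ω : E b) : inner ℝ (vec k) ω = ∑ j, (k j : ℝ) * ω j := by
  rw [PiLp.inner_apply]
  exact Finset.sum_congr rfl fun j _ => by simp [mul_comm]

lemma norm_le_sum (x : E b) : ‖x‖ ≤ ∑ j, |x j| := by
  rw [EuclideanSpace.norm_eq]
  refine Real.sqrt_le_iff.2 ⟨Finset.sum_nonneg fun _ _ => abs_nonneg _, ?_⟩
  exact Finset.sum_sq_le_sq_sum_of_nonneg fun j _ => norm_nonneg (x j)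

lemma norm_vec_le (k : Fin b → ℤ) : ‖vec k‖ ≤ b * ‖k‖ := by
  refine (norm_le_sum _).trans ?_
  calc ∑ j, |vec k j| ≤ ∑ _j : Fin b, ‖k‖ := Finset.sum_le_sum fun j _ => by
        have := norm_le_pi_norm k j
        rwa [Int.norm_eq_abs] at this
    _ = _ := by simp

/-- The spatial mode `∑ k_j n_j` attached to the temporal mode `k`. -/
def mode (n : Fin b → Fin d → ℤ) (k : Fin b → ℤ) : Fin d → ℤ := ∑ j, k j • n j

/-- The linear map `x ↦ ∑ x_j n_j`. -/
def modeL (n : Fin b → Fin d → ℤ) : E b →ₗ[ℝ] E d where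
  toFun x := ∑ j, x j • vec (n j)
  map_add' x y := by simp [add_smul, Finset.sum_add_distrib]
  map_smul' r x := by simp [mul_smul, Finset.smul_sum]

lemma vec_add (k l : Fin b → ℤ) : vec (k + l) = vec k + vec l := by
  ext j; simp

lemma vec_neg (k : Fin b → ℤ) : vec (-k) = -vec k := by
  ext j; simp

lemma vec_mode (n : Fin b → Fin d → ℤ) (k : Fin b → ℤ) :
    vec (mode n k) = ∑ j, (k j : ℝ) • vec (n j) := by
  ext i; simp [mode]

lemma vec_mode_eq (n : Fin b → Fin d → ℤ) (k : Fin b → ℤ) : vec (mode n k) = modeL n (vec k) :=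
  vec_mode n k

lemma mode_single (n : Fin b → Fin d → ℤ) (j : Fin b) : mode n (Pi.single j 1) = n j := by
  simp [mode, Pi.single_apply]

lemma exists_norm_modeL_le (n : Fin b → Fin d → ℤ) :
    ∃ C : ℝ, 0 < C ∧ ∀ x, ‖modeL n x‖ ≤ C * ‖x‖ := by
  refine ⟨‖(modeL n).toContinuousLinearMap‖ + 1, by positivity, fun x => ?_⟩
  refine ((modeL n).toContinuousLinearMap.le_opNorm x).trans ?_
  gcongr
  linarith

lemma exists_norm_vec_mode_le (n : Fin b → Fin d → ℤ) :
    ∃ C : ℝ, 0 < C ∧ ∀ k, ‖vec (mode n k)‖ ≤ C * ‖k‖ := by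
  obtain ⟨C, hC, h⟩ := exists_norm_modeL_le n
  refine ⟨C * (b + 1), by positivity, fun k => ?_⟩
  rw [vec_mode_eq]
  calc _ ≤ C * ‖vec k‖ := h _
    _ ≤ C * (b * ‖k‖) := by gcongr; exact norm_vec_le k
    _ ≤ C * ((b + 1) * ‖k‖) := by gcongr; linarith
    _ = _ := by ring

/-- An injective linear map on a finite-dimensional space is bounded below; this is the ellipticity
that excludes small divisors at infinity. -/
lemma exists_le_norm_modeL {n : Fin b → Fin d → ℤ}
    (hn : LinearIndependent ℝ fun j => vec (n j)) :
    ∃ c : ℝ, 0 < c ∧ ∀ x, c * ‖x‖ ^ 2 ≤ ‖modeL n x‖ ^ 2 := by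
  have hker : LinearMap.ker (modeL n) = ⊥ := by
    rw [LinearMap.ker_eq_bot']
    intro x hx
    ext j
    exact Fintype.linearIndependent_iff.1 hn (fun j => x j) hx j
  obtain ⟨K, hK, h⟩ := (modeL n).exists_antilipschitzWith hker
  refine ⟨((K : ℝ) ^ 2)⁻¹, by positivity, fun x => ?_⟩
  have hx : ‖x‖ ≤ K * ‖modeL n x‖ := by
    simpa using h.le_mul_dist x 0
  have hK' : (0 : ℝ) < K := hK
  rw [inv_mul_le_iff₀ (by positivity), ← mul_pow]
  gcongr

/-- The eigenvalue of the linear part at the mode `k`. -/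
def divisor (ρ : ℝ) (n : Fin b → Fin d → ℤ) (ω : E b) (k : Fin b → ℤ) : ℝ :=
  ‖vec (mode n k)‖ ^ 2 + ρ - inner ℝ (vec k) ω

/-- There are no modes that resonate with the given ones. -/
def Nonresonant (n : Fin b → Fin d → ℤ) : Prop :=
  ∀ k : Fin b → ℤ, ∑ j, k j = 1 → ‖vec (mode n k)‖ ^ 2 = ∑ j, (k j : ℝ) * ‖vec (n j)‖ ^ 2 →
    ∃ j, k = Pi.single j 1

/-- At `omega0` the divisor is an integer minus `(∑ k_j - 1) ρ`. As `ρ` is irrational, its vanishing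
forces `∑ k_j = 1`, and what remains is the resonance equation. -/
lemma exists_eq_single_of_divisor_eq_zero {ρ : ℝ} (hρ : Diophantine ρ) {n : Fin b → Fin d → ℤ}
    (hn : Nonresonant n) {k : Fin b → ℤ} (h : divisor ρ n (omega0 ρ n) k = 0) :
    ∃ j, k = Pi.single j 1 := by
  have e : divisor ρ n (omega0 ρ n) k =
      ‖vec (mode n k)‖ ^ 2 - (∑ j, (k j : ℝ) * ‖vec (n j)‖ ^ 2) - ((∑ j, k j : ℤ) - 1 : ℝ) * ρ := by
    rw [divisor, inner_vec]
    simp only [omega0, mul_add, Finset.sum_add_distrib, ← Finset.sum_mul]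
    push_cast
    ring
  have hk : ∑ j, k j = 1 := by
    by_contra hne
    obtain ⟨γ, τ, hγ, -, H⟩ := hρ
    have h0 := H (∑ j, k j - 1)
      (∑ i, mode n k i ^ 2 - ∑ j, k j * ∑ i, n j i ^ 2) (sub_ne_zero.2 hne)
    have hpos : 0 < γ / |((∑ j, k j - 1 : ℤ) : ℝ)| ^ τ := by
      have : 0 < |((∑ j, k j - 1 : ℤ) : ℝ)| := by
        rw [abs_pos, Int.cast_ne_zero]
        exact sub_ne_zero.2 hne
      positivity
    have hz : ((∑ j, k j - 1 : ℤ) : ℝ) * ρ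
        - ((∑ i, mode n k i ^ 2 - ∑ j, k j * ∑ i, n j i ^ 2 : ℤ) : ℝ) = 0 := by
      rw [e] at h
      simp only [norm_sq_vec] at h
      push_cast at h ⊢
      linarith
    rw [hz, abs_zero] at h0
    linarith
  refine hn k hk ?_
  rw [e, hk] at h
  push_cast at h
  linarith

lemma norm_le_norm_vec (k : Fin b → ℤ) : ‖k‖ ≤ ‖vec k‖ :=
  (pi_norm_le_iff_of_nonneg (norm_nonneg _)).2 fun j => by
    rw [Int.norm_eq_abs]
    exact PiLp.norm_apply_le (vec k) j

lemma finite_setOf_norm_vec_le (R : ℝ) : {k : Fin b → ℤ | ‖vec k‖ ≤ R}.Finite :=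
  ((isCompact_closedBall (0 : Fin b → ℤ) R).finite_of_discrete).subset fun k hk =>
    mem_closedBall_zero_iff.2 ((norm_le_norm_vec k).trans hk)

lemma abs_divisor_sub_le (ρ : ℝ) (n : Fin b → Fin d → ℤ) (ω ω' : E b) (k : Fin b → ℤ) :
    |divisor ρ n ω k - divisor ρ n ω' k| ≤ ‖vec k‖ * ‖ω - ω'‖ := by
  have : divisor ρ n ω k - divisor ρ n ω' k = -inner ℝ (vec k) (ω - ω') := by
    rw [divisor, divisor, inner_sub_right]; ring
  rw [this, abs_neg]
  exact abs_real_inner_le_norm _ _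

/-- Quadratic growth settles large `k`, nonresonance the finitely many others. Moving `ω` changes
the divisor only linearly in `k`, so a whole ball of frequencies is covered. -/
lemma exists_le_abs_divisor {ρ : ℝ} (hρ : Diophantine ρ) {n : Fin b → Fin d → ℤ}
    (hli : LinearIndependent ℝ fun j => vec (n j)) (hn : Nonresonant n) :
    ∃ c : ℝ, 0 < c ∧ ∀ k : Fin b → ℤ, (¬∃ j, k = Pi.single j 1) → ∀ ω : E b,
      ‖ω - omega0 ρ n‖ ≤ c → c * (1 + ‖vec k‖ ^ 2) ≤ |divisor ρ n ω k| := by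
  obtain ⟨c₀, hc₀, h₀⟩ := exists_le_norm_modeL hli
  set w := ‖omega0 ρ n‖ with hw
  obtain ⟨R, hR0, hR⟩ : ∃ R : ℝ, 0 ≤ R ∧ ∀ x : ℝ, R ≤ x →
      c₀ / 2 * (1 + x ^ 2) ≤ c₀ * x ^ 2 - |ρ| - x * w := by
    refine ⟨1 + 2 / c₀ * (c₀ / 2 + |ρ| + w), by positivity, fun x hx => ?_⟩
    have hw0 : 0 ≤ w := norm_nonneg _
    have h1 : 0 ≤ 2 / c₀ * (c₀ / 2 + |ρ| + w) := by positivity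
    have hx1 : 1 ≤ x := by linarith
    have h2 : c₀ / 2 + |ρ| + w ≤ c₀ / 2 * x := by
      have : 2 / c₀ * (c₀ / 2 + |ρ| + w) ≤ x := by linarith
      calc c₀ / 2 + |ρ| + w = c₀ / 2 * (2 / c₀ * (c₀ / 2 + |ρ| + w)) := by field_simp
        _ ≤ _ := by gcongr
    have h3 : (c₀ / 2 + |ρ| + w) * x ≤ c₀ / 2 * x * x := by gcongr
    have h4 := abs_nonneg ρ
    nlinarith [mul_nonneg h4 (sub_nonneg.2 hx1), mul_nonneg hc₀.le (sub_nonneg.2 hx1)]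
  have hbig : ∀ k : Fin b → ℤ, R ≤ ‖vec k‖ →
      c₀ / 2 * (1 + ‖vec k‖ ^ 2) ≤ |divisor ρ n (omega0 ρ n) k| := by
    intro k hk
    refine (hR _ hk).trans (le_trans ?_ (le_abs_self _))
    have h1 := h₀ (vec k)
    rw [← vec_mode_eq] at h1
    have h2 := (le_abs_self _).trans (abs_real_inner_le_norm (vec k) (omega0 ρ n))
    have h3 := neg_abs_le ρ
    rw [divisor]
    linarith
  obtain ⟨c₁, hc₁, h₁⟩ : ∃ c₁ : ℝ, 0 < c₁ ∧ ∀ k : Fin b → ℤ, (¬∃ j, k = Pi.single j 1) →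
      ‖vec k‖ ≤ R → c₁ ≤ |divisor ρ n (omega0 ρ n) k| := by
    have hfin : {k : Fin b → ℤ | ‖vec k‖ ≤ R ∧ ¬∃ j, k = Pi.single j 1}.Finite :=
      (finite_setOf_norm_vec_le R).subset fun k hk => hk.1
    rcases hfin.toFinset.eq_empty_or_nonempty with he | hne
    · exact ⟨1, one_pos, fun k h1 h2 => absurd (hfin.mem_toFinset.2 ⟨h2, h1⟩)
        (Finset.eq_empty_iff_forall_notMem.1 he k)⟩
    · obtain ⟨k₀, hk₀, hmin⟩ := Finset.exists_min_image hfin.toFinset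
        (fun k => |divisor ρ n (omega0 ρ n) k|) hne
      refine ⟨_, abs_pos.2 fun h => ?_, fun k h1 h2 => hmin k (hfin.mem_toFinset.2 ⟨h2, h1⟩)⟩
      have := exists_eq_single_of_divisor_eq_zero hρ hn h
      exact ((hfin.mem_toFinset).1 hk₀).2 this
  -- The common constant for large and small `k` at `omega0`; half of it is given up for `ω` near
  -- `omega0`.
  set c₂ := min (c₀ / 2) (c₁ / (1 + R ^ 2)) with hc₂
  have hc₂0 : 0 < c₂ := lt_min (by positivity) (by positivity)
  refine ⟨c₂ / 2, by positivity, fun k hk ω hω => ?_⟩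
  have hmain : c₂ * (1 + ‖vec k‖ ^ 2) ≤ |divisor ρ n (omega0 ρ n) k| := by
    rcases le_total R ‖vec k‖ with h | h
    · exact le_trans (by gcongr; exact min_le_left _ _) (hbig k h)
    · refine le_trans ?_ (h₁ k hk h)
      calc c₂ * (1 + ‖vec k‖ ^ 2) ≤ c₁ / (1 + R ^ 2) * (1 + R ^ 2) := by
            gcongr
            exact min_le_right _ _
        _ = c₁ := by field_simp
  have h1 := abs_divisor_sub_le ρ n ω (omega0 ρ n) k
  have h2 : ‖vec k‖ * ‖ω - omega0 ρ n‖ ≤ (1 + ‖vec k‖ ^ 2) * (c₂ / 2) := by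
    gcongr
    nlinarith [sq_nonneg (‖vec k‖ - 1)]
  have h3 := abs_sub_abs_le_abs_sub (divisor ρ n (omega0 ρ n) k) (divisor ρ n ω k)
  rw [abs_sub_comm] at h3
  linarith

open Classical in
/-- The multiplier that solves the linear equation off the resonant modes. -/
def multiplier (ς ρ : ℝ) (n : Fin b → Fin d → ℤ) (ω : E b) (k : Fin b → ℤ) : ℝ :=
  if ∃ j, k = Pi.single j 1 then 0 else -(ς * ‖vec (mode n k)‖ ^ 2) / divisor ρ n ω k

/-- Numerator and divisor are both quadratic in `k`, so no derivative is lost. A change of `ω`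
brings in a factor `|k|`, which the second divisor in the denominator absorbs. -/
lemma exists_multiplier_bound (ς : ℝ) {ρ : ℝ} (hρ : Diophantine ρ) {n : Fin b → Fin d → ℤ}
    (hli : LinearIndependent ℝ fun j => vec (n j)) (hn : Nonresonant n) :
    ∃ c K : ℝ, 0 < c ∧ 0 < K ∧
      (∀ k, (¬∃ j, k = Pi.single j 1) → ∀ ω, ‖ω - omega0 ρ n‖ ≤ c → divisor ρ n ω k ≠ 0) ∧
      (∀ k, ∀ ω, ‖ω - omega0 ρ n‖ ≤ c → |multiplier ς ρ n ω k| ≤ K) ∧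
      (∀ k, ∀ ω ω', ‖ω - omega0 ρ n‖ ≤ c → ‖ω' - omega0 ρ n‖ ≤ c →
        |multiplier ς ρ n ω k - multiplier ς ρ n ω' k| ≤ K * ‖ω - ω'‖) := by
  obtain ⟨c, hc, h⟩ := exists_le_abs_divisor hρ hli hn
  obtain ⟨C, hC, hm⟩ := exists_norm_modeL_le n
  have hnum : ∀ k, |ς * ‖vec (mode n k)‖ ^ 2| ≤ (|ς| * C ^ 2) * (1 + ‖vec k‖ ^ 2) := by
    intro k
    rw [abs_mul, abs_of_nonneg (sq_nonneg ‖vec (mode n k)‖), mul_assoc]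
    gcongr
    rw [vec_mode_eq]
    calc ‖modeL n (vec k)‖ ^ 2 ≤ (C * ‖vec k‖) ^ 2 := by gcongr; exact hm _
      _ = C ^ 2 * ‖vec k‖ ^ 2 := by ring
      _ ≤ C ^ 2 * (1 + ‖vec k‖ ^ 2) := by gcongr; linarith
  refine ⟨c, |ς| * C ^ 2 / c + |ς| * C ^ 2 / c ^ 2 + 1, hc, by positivity, ?_, ?_, ?_⟩
  · intro k hk ω hω h0
    have := h k hk ω hω
    rw [h0, abs_zero] at this
    exact absurd this (not_le.2 (by positivity))
  · intro k ω hω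
    rw [multiplier]
    split_ifs with hk
    · rw [abs_zero]; positivity
    · have h1 := h k hk ω hω
      rw [abs_div, abs_neg]
      calc _ ≤ (|ς| * C ^ 2) * (1 + ‖vec k‖ ^ 2) / (c * (1 + ‖vec k‖ ^ 2)) := by
            gcongr
            exact hnum k
        _ = |ς| * C ^ 2 / c := by field_simp
        _ ≤ _ := by linarith [show 0 ≤ |ς| * C ^ 2 / c ^ 2 by positivity]
  · intro k ω ω' hω hω'
    rw [multiplier, multiplier]
    split_ifs with hk
    · rw [sub_zero, abs_zero]; positivity
    · have h1 := h k hk ω hω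
      have h2 := h k hk ω' hω'
      have hp : 0 < c * (1 + ‖vec k‖ ^ 2) := by positivity
      have h0 : divisor ρ n ω k ≠ 0 := abs_pos.1 (hp.trans_le h1)
      have h0' : divisor ρ n ω' k ≠ 0 := abs_pos.1 (hp.trans_le h2)
      have e : -(ς * ‖vec (mode n k)‖ ^ 2) / divisor ρ n ω k
          - -(ς * ‖vec (mode n k)‖ ^ 2) / divisor ρ n ω' k =
          (ς * ‖vec (mode n k)‖ ^ 2) * (divisor ρ n ω k - divisor ρ n ω' k) /
            (divisor ρ n ω k * divisor ρ n ω' k) := by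
        field_simp
        ring
      have h3 : |divisor ρ n ω k - divisor ρ n ω' k| ≤ (1 + ‖vec k‖ ^ 2) * ‖ω - ω'‖ := by
        refine (abs_divisor_sub_le ρ n ω ω' k).trans ?_
        gcongr
        nlinarith [sq_nonneg (‖vec k‖ - 1)]
      rw [e, abs_div, abs_mul _ (divisor ρ n ω k - _), abs_mul (divisor ρ n ω k)]
      calc _ ≤ (|ς| * C ^ 2) * (1 + ‖vec k‖ ^ 2) * ((1 + ‖vec k‖ ^ 2) * ‖ω - ω'‖) /
              ((c * (1 + ‖vec k‖ ^ 2)) * (c * (1 + ‖vec k‖ ^ 2))) := by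
            exact div_le_div₀ (by positivity)
              (mul_le_mul (hnum k) h3 (abs_nonneg _) (by positivity)) (by positivity)
              (mul_le_mul h1 h2 hp.le (abs_nonneg _))
        _ = |ς| * C ^ 2 / c ^ 2 * ‖ω - ω'‖ := by field_simp
        _ ≤ _ := by
            gcongr
            linarith [show 0 ≤ |ς| * C ^ 2 / c by positivity]

end Resonances

/-! ### The leading part, its cubic self-interaction, and the linear solver. -/

section LeadingPart

open Wiener

variable {d b : ℕ} {μ : ℝ≥0}

/-- The leading part `∑ a_j e^{iθ_j}`. -/
def lead (μ : ℝ≥0) (a : E b) : Wiener (Fin b → ℤ) μ := ∑ j, a j • X (Pi.single j 1)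

lemma single_one_inj {x y : Fin b} :
    (Pi.single x 1 : Fin b → ℤ) = Pi.single y 1 ↔ x = y :=
  ⟨fun h => by
    by_contra hne
    have := congrFun h x
    simp [Pi.single_eq_of_ne hne] at this, fun h => h ▸ rfl⟩

lemma coeff_lead_single (a : E b) (j : Fin b) : coeff (lead μ a) (Pi.single j 1) = a j := by
  classical
  rw [lead, coeff_sum]
  simp [coeff_X, single_one_inj]

lemma coeff_lead_of_ne (a : E b) {k : Fin b → ℤ} (hk : ¬∃ j, k = Pi.single j 1) :
    coeff (lead μ a) k = 0 := by
  classical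
  rw [lead, coeff_sum]
  refine Finset.sum_eq_zero fun j _ => ?_
  rw [coeff_smul, coeff_X, if_neg fun h => hk ⟨j, h⟩, mul_zero]

lemma norm_lead_le (a : E b) {ε : ℝ} (ha : ∀ j, |a j| ≤ 2 * ε) :
    ‖lead μ a‖ ≤ (2 * ∑ j : Fin b, wt μ (Pi.single j 1 : Fin b → ℤ)) * ε := by
  refine (norm_sum_le _ _).trans ?_
  rw [Finset.mul_sum, Finset.sum_mul]
  refine Finset.sum_le_sum fun j _ => ?_
  rw [norm_smul, norm_X, Real.norm_eq_abs]
  have := wt_pos (μ := μ) (Pi.single j 1 : Fin b → ℤ)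
  calc _ ≤ 2 * ε * wt μ (Pi.single j 1 : Fin b → ℤ) := by gcongr; exact ha j
    _ = _ := by ring

lemma single_eq_add_sub_iff (j p q m : Fin b) :
    (Pi.single j 1 : Fin b → ℤ) = Pi.single p 1 + Pi.single q 1 + -Pi.single m 1 ↔
      (p = j ∧ q = m) ∨ (p = m ∧ q = j) := by
  have inj : ∀ {x y : Fin b}, (Pi.single x 1 : Fin b → ℤ) = Pi.single y 1 → x = y :=
    fun h => single_one_inj.1 h
  constructor
  · intro h
    have h' : (Pi.single j 1 : Fin b → ℤ) + Pi.single m 1 = Pi.single p 1 + Pi.single q 1 := by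
      rw [h]; abel
    by_cases hp : p = j
    · subst hp
      exact Or.inl ⟨rfl, inj (add_left_cancel h').symm⟩
    · by_cases hq : q = j
      · subst hq
        rw [add_comm (Pi.single p 1)] at h'
        exact Or.inr ⟨inj (add_left_cancel h').symm, rfl⟩
      · have := congrFun h' j
        simp only [Pi.add_apply, Pi.single_eq_same, Pi.single_eq_of_ne (Ne.symm hp),
          Pi.single_eq_of_ne (Ne.symm hq), Pi.single_apply] at this
        split_ifs at this <;> omega
  · rintro (⟨rfl, rfl⟩ | ⟨rfl, rfl⟩) <;> abel

/-- In `|u|²u` the triple `e_p + e_q - e_m` hits `e_j` when `p = j, q = m` or `q = j, p = m`. Each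
family sums to `a_j ∑ a_l²`, and the common triple `p = q = m = j` must be subtracted once. -/
lemma coeff_cubic_lead (a : E b) (j : Fin b) :
    coeff (lead μ a ^ 2 * bar (lead μ a)) (Pi.single j 1) =
      (2 * (∑ l, a l ^ 2) - a j ^ 2) * a j := by
  classical
  have e : lead μ a ^ 2 * bar (lead μ a) = ∑ p, ∑ q, ∑ m, (a p * a q * a m) •
      (X (Pi.single p 1 + Pi.single q 1 + -Pi.single m 1) : Wiener (Fin b → ℤ) μ) := by
    rw [sq, lead, map_sum, Finset.sum_mul_sum, Finset.sum_mul]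
    refine Finset.sum_congr rfl fun p _ => ?_
    rw [Finset.sum_mul]
    refine Finset.sum_congr rfl fun q _ => ?_
    rw [Finset.mul_sum]
    refine Finset.sum_congr rfl fun m _ => ?_
    rw [map_smul, bar_X, smul_mul_smul_comm, smul_mul_smul_comm, X_mul_X, X_mul_X]
  have ind : ∀ p q m : Fin b, coeff (X (Pi.single p 1 + Pi.single q 1 + -Pi.single m 1) :
      Wiener (Fin b → ℤ) μ) (Pi.single j 1) =
      (if p = j then if q = m then 1 else 0 else 0) + (if p = m then if q = j then 1 else 0 else 0)
        - (if p = j then if q = j then if m = j then 1 else 0 else 0 else 0) := by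
    intro p q m
    simp only [coeff_X, single_eq_add_sub_iff]
    by_cases hp : p = j
    · subst hp
      by_cases hq : q = m
      · subst hq
        by_cases h : p = q
        · subst h; simp
        · simp [h, Ne.symm h]
      · by_cases hqp : q = p
        · subst hqp
          simp [hq, Ne.symm hq]
        · simp [hq, hqp]
    · simp [hp, ite_and]
  rw [e, coeff_sum]
  simp only [coeff_sum, coeff_smul, ind, mul_add, mul_sub, Finset.sum_add_distrib,
    Finset.sum_sub_distrib, mul_ite, mul_one, mul_zero, Finset.sum_ite_irrel,
    Finset.sum_const_zero, Finset.sum_ite_eq, Finset.sum_ite_eq', Finset.mem_univ, if_true]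
  rw [sub_mul, mul_assoc 2, Finset.sum_mul, two_mul]
  congr 1
  · congr 1 <;> exact Finset.sum_congr rfl fun _ _ => by ring
  · ring

lemma exists_solver (ς : ℝ) {ρ : ℝ} (hρ : Diophantine ρ) {n : Fin b → Fin d → ℤ}
    (hli : LinearIndependent ℝ fun j => vec (n j)) (hn : Nonresonant n) :
    ∃ (c K : ℝ) (S : E b → Wiener (Fin b → ℤ) μ → Wiener (Fin b → ℤ) μ), 0 < c ∧ 0 < K ∧
      (∀ k, (¬∃ j, k = Pi.single j 1) → ∀ ω, ‖ω - omega0 ρ n‖ ≤ c → divisor ρ n ω k ≠ 0) ∧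
      (∀ ω, ‖ω - omega0 ρ n‖ ≤ c → ∀ u k, coeff (S ω u) k = multiplier ς ρ n ω k * coeff u k) ∧
      (∀ ω, ‖ω - omega0 ρ n‖ ≤ c → ∀ u u', ‖S ω u - S ω u'‖ ≤ K * ‖u - u'‖) ∧
      (∀ ω ω', ‖ω - omega0 ρ n‖ ≤ c → ‖ω' - omega0 ρ n‖ ≤ c → ∀ u,
        ‖S ω u - S ω' u‖ ≤ K * ‖ω - ω'‖ * ‖u‖) ∧
      ∀ ω, S ω 0 = 0 := by
  classical
  obtain ⟨c, K, hc, hK, h1, h2, h3⟩ := exists_multiplier_bound ς hρ hli hn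
  -- Outside the ball the multiplier need not be bounded, so the solver gets the default value zero
  -- there.
  refine ⟨c, K, fun ω => if h : ‖ω - omega0 ρ n‖ ≤ c then
    diag (multiplier ς ρ n ω) K (fun k => h2 k ω h) else fun _ => 0, hc, hK, h1, ?_, ?_, ?_, ?_⟩
  · intro ω hω u k
    simp only [dif_pos hω, coeff_diag]
  · intro ω hω u u'
    simp only [dif_pos hω, ← map_sub]
    exact norm_diag_apply_le _ _ hK.le _ _
  · intro ω ω' hω hω' u
    simp only [dif_pos hω, dif_pos hω']
    have e : diag (multiplier ς ρ n ω) K (fun k => h2 k ω hω) u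
        - diag (multiplier ς ρ n ω') K (fun k => h2 k ω' hω') u =
        diag (fun k => multiplier ς ρ n ω k - multiplier ς ρ n ω' k) (K * ‖ω - ω'‖)
          (fun k => h3 k ω ω' hω hω') u := by
      ext k
      rw [coeff_sub, coeff_diag, coeff_diag, coeff_diag, sub_mul]
    rw [e]
    exact norm_diag_apply_le _ _ (by positivity) _ _
  · intro ω
    dsimp only
    split_ifs <;> simp

lemma exists_fixedPoint_of_half_lipschitz {Z : Type*} [MetricSpace Z] {s : Set Z}
    (hs : IsComplete s) {x₀ : Z} (hx₀ : x₀ ∈ s) {T : Z → Z} (hT : Set.MapsTo T s s)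
    (h : ∀ x ∈ s, ∀ y ∈ s, dist (T x) (T y) ≤ 1 / 2 * dist x y) : ∃ x ∈ s, T x = x := by
  have hc : ContractingWith (1 / 2 : ℝ≥0) (hT.restrict T s s) := by
    refine ⟨by norm_num [← NNReal.coe_lt_coe], LipschitzWith.of_dist_le_mul fun x y => ?_⟩
    exact (h x x.2 y y.2).trans_eq (by simp [Subtype.dist_eq])
  obtain ⟨y, hy, hfix, -⟩ := hc.exists_fixedPoint' hs hT hx₀ (edist_ne_top _ _)
  exact ⟨y, hy, hfix⟩

end LeadingPart

/-! ### The Lyapunov–Schmidt fixed point. -/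

section LyapunovSchmidt

open Wiener

variable {d b : ℕ} {μ : ℝ≥0}

/-- The frequency shift read off from the resonant modes of the nonlinear term. -/
def freqShift (ς : ℝ) (n : Fin b → Fin d → ℤ) (a : E b) (w : Wiener (Fin b → ℤ) μ) : E b :=
  WithLp.toLp 2 fun j => ς * ‖vec (n j)‖ ^ 2 * coeff w (Pi.single j 1) / a j

lemma freqShift_zero (ς : ℝ) (n : Fin b → Fin d → ℤ) (a : E b) :
    freqShift ς n a (0 : Wiener (Fin b → ℤ) μ) = 0 := by
  ext j
  simp [freqShift]

/-- Dividing by `a_j` costs a factor `1 / ε`: an error `ε⁴` in the nonlinearity becomes `ε³` in the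
frequency. -/
lemma abs_freqShift_sub_le (ς : ℝ) (n : Fin b → Fin d → ℤ) {a : E b} {ε : ℝ} (hε : 0 < ε)
    (ha : ∀ j, ε ≤ |a j|) (w w' : Wiener (Fin b → ℤ) μ) (j : Fin b) :
    |freqShift ς n a w j - freqShift ς n a w' j| ≤ |ς| * ‖vec (n j)‖ ^ 2 * (‖w - w'‖ / ε) := by
  have e : freqShift ς n a w j - freqShift ς n a w' j =
      ς * ‖vec (n j)‖ ^ 2 * (coeff (w - w') (Pi.single j 1) / a j) := by
    rw [coeff_sub, freqShift, freqShift]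
    dsimp only
    ring
  rw [e, abs_mul, abs_mul, abs_of_nonneg (sq_nonneg ‖vec (n j)‖), abs_div]
  gcongr
  · exact abs_coeff_le _ _
  · exact ha j

lemma norm_freqShift_sub_le (ς : ℝ) (n : Fin b → Fin d → ℤ) {a : E b} {ε : ℝ} (hε : 0 < ε)
    (ha : ∀ j, ε ≤ |a j|) (w w' : Wiener (Fin b → ℤ) μ) :
    ‖freqShift ς n a w - freqShift ς n a w'‖ ≤
      (∑ j, |ς| * ‖vec (n j)‖ ^ 2) * (‖w - w'‖ / ε) := by
  refine (norm_le_sum _).trans ?_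
  rw [Finset.sum_mul]
  exact Finset.sum_le_sum fun j _ => abs_freqShift_sub_le ς n hε ha w w' j

/-- The equations at `k ≠ e_j` read `v = S ω (N v)`, those at `e_j` read `ω = omega0 + freqShift (N
v)`. On a product of balls the right-hand sides form a contraction, since `N` has Lipschitz constant
`O(ε²)` and size `O(ε³)`. -/
theorem exists_lyapunovSchmidt_solution (μ : ℝ≥0) (ς : ℝ) {ρ : ℝ} (hρ : Diophantine ρ)
    {n : Fin b → Fin d → ℤ} (hli : LinearIndependent ℝ fun j => vec (n j)) (hn : Nonresonant n)
    {α : ℕ → ℕ → ℝ} {r : ℝ} (hr : 0 < r) (hα : ConvergesAt α r) :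
    ∃ ε₁ C : ℝ, 0 < ε₁ ∧ 0 < C ∧ ∀ ε : ℝ, 0 < ε → ε < ε₁ → ∀ a : E b,
      (∀ j, ε ≤ |a j|) → (∀ j, |a j| ≤ 2 * ε) →
      ∃ (v : Wiener (Fin b → ℤ) μ) (ω : E b),
        ‖v‖ ≤ C * ε ^ 3 ∧ ‖lead μ a + v‖ ≤ r / 4 ∧ ‖ω - omega0 ρ n‖ ≤ C * ε ^ 2 ∧
        (∀ j, coeff v (Pi.single j 1) = 0) ∧
        (∀ k, divisor ρ n ω k * coeff (lead μ a + v) k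
          + ς * ‖vec (mode n k)‖ ^ 2 * coeff (nonlin α (lead μ a + v)) k = 0) ∧
        ∀ j, |ω j - (‖vec (n j)‖ ^ 2 + ρ
            + ς * (‖vec (n j)‖ ^ 2 * (4 * (∑ l, a l ^ 2) - 2 * a j ^ 2)))| ≤ C * ε ^ 3 := by
  obtain ⟨c, K, S, hc, hK, hdiv, hS, hSu, hSω, hS0⟩ :=
    exists_solver (μ := μ) ς hρ hli hn
  obtain ⟨L, hL, hN⟩ := norm_nonlin_sub_le (G := Fin b → ℤ) (μ := μ) hr hα
  -- Chosen so that `‖lead μ a + v‖ ≤ W ε` whenever `‖v‖ ≤ ε`.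
  set W : ℝ := (2 * ∑ j : Fin b, wt μ (Pi.single j 1 : Fin b → ℤ)) + 1 with hW
  have hW1 : 1 ≤ W := by
    have : 0 ≤ ∑ j : Fin b, wt μ (Pi.single j 1 : Fin b → ℤ) :=
      Finset.sum_nonneg fun j _ => (wt_pos _).le
    linarith
  set P : ℝ := ∑ j, |ς| * ‖vec (n j)‖ ^ 2 with hP
  have hP0 : 0 ≤ P := Finset.sum_nonneg fun j _ => by positivity
  set M : ℝ := (K + P + 1) * (L * W ^ 3) with hM
  have hM0 : 0 < M := by positivity
  have hKM : K * (L * W ^ 3) ≤ M := by rw [hM]; gcongr; linarith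
  have hPM : P * (L * W ^ 3) ≤ M := by rw [hM]; gcongr; linarith
  have hW23 : L * W ^ 2 ≤ L * W ^ 3 := by gcongr; omega
  have hKM2 : K * (L * W ^ 2) ≤ M := le_trans (by gcongr) hKM
  have hPM2 : P * (L * W ^ 2) ≤ M := le_trans (by gcongr) hPM
  -- In turn, the bounds on `ε` give Lipschitz constant `1 / 2` (and keep `v` in its ball), keep `ω`
  -- in its ball, keep `u` in the domain of convergence, and allow powers of `ε` to be dropped. In
  -- the constant, `M` bounds `v` and `ω`, the rest the frequency error.
  refine ⟨min (min (1 / (4 * M)) (c / M)) (min (r / 4 / W) 1),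
    M + P * (L * W ^ 2 * M + L * W ^ 4), by positivity, by positivity, ?_⟩
  intro ε hε hε₁ a ha ha2
  have hε1 : ε * (4 * M) < 1 := by
    rw [← lt_div_iff₀ (by positivity)]
    exact hε₁.trans_le ((min_le_left _ _).trans (min_le_left _ _))
  have hεc : ε * M < c := by
    rw [← lt_div_iff₀ (by positivity)]
    exact hε₁.trans_le ((min_le_left _ _).trans (min_le_right _ _))
  have hεr : W * ε < r / 4 := by
    rw [mul_comm, ← lt_div_iff₀ (by positivity)]
    exact hε₁.trans_le ((min_le_right _ _).trans (min_le_left _ _))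
  have hε2 : ε < 1 := hε₁.trans_le ((min_le_right _ _).trans (min_le_right _ _))
  have hη : 0 < W * ε := by positivity
  have hu : ∀ v : Wiener (Fin b → ℤ) μ, ‖v‖ ≤ ε → ‖lead μ a + v‖ ≤ W * ε := fun v hv => by
    refine (norm_add_le _ _).trans ?_
    rw [hW, add_mul, one_mul]
    exact add_le_add (norm_lead_le a ha2) hv
  set N : Wiener (Fin b → ℤ) μ → Wiener (Fin b → ℤ) μ := fun v => nonlin α (lead μ a + v) with hNdef
  have hNsub : ∀ v v', ‖v‖ ≤ ε → ‖v'‖ ≤ ε → ‖N v - N v'‖ ≤ L * W ^ 2 * ε ^ 2 * ‖v - v'‖ := by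
    intro v v' hv hv'
    have := (hN (W * ε) hη hεr.le _ _ (hu v hv) (hu v' hv')).1
    rw [add_sub_add_left_eq_sub] at this
    exact this.trans_eq (by ring)
  have hNle : ∀ v, ‖v‖ ≤ ε → ‖N v‖ ≤ L * W ^ 3 * ε ^ 3 := by
    intro v hv
    have := (hN (W * ε) hη hεr.le _ 0 (hu v hv) (by rw [norm_zero]; exact hη.le)).1
    rw [nonlin_zero, sub_zero, sub_zero] at this
    calc ‖N v‖ ≤ L * (W * ε) ^ 2 * ‖lead μ a + v‖ := this
      _ ≤ L * (W * ε) ^ 2 * (W * ε) := by gcongr; exact hu v hv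
      _ = _ := by ring
  set T : Wiener (Fin b → ℤ) μ × E b → Wiener (Fin b → ℤ) μ × E b := fun z =>
    (S z.2 (N z.1), omega0 ρ n + freqShift ς n a (N z.1)) with hT
  set s : Set (Wiener (Fin b → ℤ) μ × E b) :=
    Metric.closedBall 0 ε ×ˢ Metric.closedBall (omega0 ρ n) c with hs
  have mem_s : ∀ z, z ∈ s ↔ ‖z.1‖ ≤ ε ∧ ‖z.2 - omega0 ρ n‖ ≤ c := fun z => by
    rw [hs, Set.mem_prod, mem_closedBall_zero_iff, mem_closedBall_iff_norm]
  have hbd : ∀ z, ‖z.1‖ ≤ ε → ‖z.2 - omega0 ρ n‖ ≤ c →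
      ‖(T z).1‖ ≤ M * ε ^ 3 ∧ ‖(T z).2 - omega0 ρ n‖ ≤ M * ε ^ 2 := by
    intro z h1 h2
    constructor
    · have := hSu z.2 h2 (N z.1) 0
      rw [hS0, sub_zero, sub_zero] at this
      calc ‖(T z).1‖ ≤ K * ‖N z.1‖ := this
        _ ≤ K * (L * W ^ 3 * ε ^ 3) := by gcongr; exact hNle _ h1
        _ = K * (L * W ^ 3) * ε ^ 3 := by ring
        _ ≤ _ := by gcongr
    · have := norm_freqShift_sub_le ς n hε ha (N z.1) 0
      rw [freqShift_zero, sub_zero, sub_zero] at this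
      calc ‖(T z).2 - omega0 ρ n‖ = ‖freqShift ς n a (N z.1)‖ := by
            rw [hT]; dsimp only; rw [add_sub_cancel_left]
        _ ≤ P * (‖N z.1‖ / ε) := this
        _ ≤ P * (L * W ^ 3 * ε ^ 3 / ε) := by gcongr; exact hNle _ h1
        _ = P * (L * W ^ 3) * ε ^ 2 := by field_simp
        _ ≤ _ := by gcongr
  have hmaps : Set.MapsTo T s s := by
    intro z hz
    obtain ⟨h1, h2⟩ := (mem_s z).1 hz
    obtain ⟨h3, h4⟩ := hbd z h1 h2
    refine (mem_s _).2 ⟨h3.trans ?_, h4.trans ?_⟩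
    · have : M * ε ≤ 1 := by linarith
      calc M * ε ^ 3 = M * ε * ε * ε := by ring
        _ ≤ 1 * 1 * ε := by gcongr
        _ = ε := by ring
    · calc M * ε ^ 2 = ε * M * ε := by ring
        _ ≤ c * 1 := by gcongr
        _ = c := mul_one c
  have hcontr : ∀ x ∈ s, ∀ y ∈ s, dist (T x) (T y) ≤ 1 / 2 * dist x y := by
    intro x hx y hy
    obtain ⟨hx1, hx2⟩ := (mem_s x).1 hx
    obtain ⟨hy1, hy2⟩ := (mem_s y).1 hy
    have d1 : ‖x.1 - y.1‖ ≤ dist x y := by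
      rw [← dist_eq_norm, Prod.dist_eq]; exact le_max_left _ _
    have d2 : ‖x.2 - y.2‖ ≤ dist x y := by
      rw [← dist_eq_norm, Prod.dist_eq]; exact le_max_right _ _
    have hD : 0 ≤ dist x y := dist_nonneg
    rw [Prod.dist_eq]
    refine max_le ?_ ?_
    · rw [dist_eq_norm]
      have e : (T x).1 - (T y).1 = (S x.2 (N x.1) - S x.2 (N y.1))
          + (S x.2 (N y.1) - S y.2 (N y.1)) := by
        rw [hT]; abel
      calc ‖(T x).1 - (T y).1‖ ≤ K * ‖N x.1 - N y.1‖ + K * ‖x.2 - y.2‖ * ‖N y.1‖ := by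
            rw [e]
            exact (norm_add_le _ _).trans
              (add_le_add (hSu _ hx2 _ _) (hSω _ _ hx2 hy2 _))
        _ ≤ K * (L * W ^ 2 * ε ^ 2 * dist x y) + K * dist x y * (L * W ^ 3 * ε ^ 3) := by
            gcongr
            · exact (hNsub _ _ hx1 hy1).trans (by gcongr)
            · exact hNle _ hy1
        _ = (K * (L * W ^ 2) * ε ^ 2 + K * (L * W ^ 3) * ε ^ 3) * dist x y := by ring
        _ ≤ (M * ε * 1 + M * ε * 1) * dist x y := by
            have e2 : ε ^ 2 ≤ ε * 1 := by rw [sq]; gcongr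
            have e3 : ε ^ 3 ≤ ε * 1 := by
              rw [show ε ^ 3 = ε * (ε * ε) by ring]
              gcongr
              nlinarith
            rw [mul_assoc M]
            gcongr
        _ ≤ 1 / 2 * dist x y := by
            gcongr
            linarith
    · rw [dist_eq_norm]
      calc ‖(T x).2 - (T y).2‖ = ‖freqShift ς n a (N x.1) - freqShift ς n a (N y.1)‖ := by
            rw [hT]; dsimp only; rw [add_sub_add_left_eq_sub]
        _ ≤ P * (‖N x.1 - N y.1‖ / ε) := norm_freqShift_sub_le ς n hε ha _ _
        _ ≤ P * (L * W ^ 2 * ε ^ 2 * dist x y / ε) := by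
            gcongr
            exact (hNsub _ _ hx1 hy1).trans (by gcongr)
        _ = P * (L * W ^ 2) * ε * dist x y := by field_simp
        _ ≤ M * ε * dist x y := by gcongr
        _ ≤ 1 / 2 * dist x y := by
            gcongr
            linarith
  have hcomplete : IsComplete s :=
    (Metric.isClosed_closedBall.prod Metric.isClosed_closedBall).isComplete
  obtain ⟨⟨v, ω⟩, hz, hfix⟩ := exists_fixedPoint_of_half_lipschitz hcomplete
    (x₀ := (0, omega0 ρ n)) ((mem_s _).2 (by simp [hε.le, hc.le])) hmaps hcontr
  obtain ⟨hv, hω⟩ := (mem_s _).1 hz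
  dsimp only at hv hω
  -- The fixed point lies in the image of `T`, which improves `‖v‖ ≤ ε` to order `ε³` and the
  -- frequency bound to order `ε²`.
  obtain ⟨hv3, hω2⟩ := hbd (v, ω) hv hω
  rw [hfix] at hv3 hω2
  dsimp only at hv3 hω2
  have hfv : v = S ω (N v) := (congrArg Prod.fst hfix).symm
  have hfω : ω = omega0 ρ n + freqShift ς n a (N v) := (congrArg Prod.snd hfix).symm
  have hC : M ≤ M + P * (L * W ^ 2 * M + L * W ^ 4) := by
    have : 0 ≤ P * (L * W ^ 2 * M + L * W ^ 4) := by positivity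
    linarith
  have hcoeff : ∀ k, coeff v k = multiplier ς ρ n ω k * coeff (N v) k := fun k => by
    conv_lhs => rw [hfv]
    exact hS ω hω _ k
  have hres : ∀ j, coeff v (Pi.single j 1) = 0 := fun j => by
    rw [hcoeff, multiplier, if_pos ⟨j, rfl⟩, zero_mul]
  have ha0 : ∀ j, a j ≠ 0 := fun j => abs_pos.1 (hε.trans_le (ha j))
  have hωj : ∀ j, ω j = ‖vec (n j)‖ ^ 2 + ρ
      + ς * ‖vec (n j)‖ ^ 2 * coeff (N v) (Pi.single j 1) / a j := fun j => by
    conv_lhs => rw [hfω]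
    rfl
  refine ⟨v, ω, hv3.trans (by gcongr), (hu v hv).trans hεr.le, hω2.trans (by gcongr), hres,
    fun k => ?_, fun j => ?_⟩
  · by_cases hk : ∃ j, k = Pi.single j 1
    · obtain ⟨j, rfl⟩ := hk
      rw [coeff_add, coeff_lead_single, hres, add_zero, mode_single, divisor, inner_vec,
        mode_single]
      have : ∑ i, ((Pi.single j 1 : Fin b → ℤ) i : ℝ) * ω i = ω j := by
        rw [Finset.sum_eq_single j] <;> simp +contextual
      rw [this, hωj j]
      have := ha0 j
      field_simp
      ring
    · have h0 := hdiv k hk ω hω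
      rw [coeff_add, coeff_lead_of_ne a hk, zero_add, hcoeff, multiplier, if_neg hk]
      field_simp
      ring
  · have h1 := (hN (W * ε) hη hεr.le _ _ (hu v hv) (hu 0 (by rw [norm_zero]; exact hε.le)))
    rw [add_zero, add_sub_cancel_left] at h1
    -- The correction `v` changes the nonlinearity by `ε² · ε³`, the terms beyond the cubic one by
    -- `ε⁴`.
    have hw : ‖N v - (2 : ℝ) • (lead μ a ^ 2 * bar (lead μ a))‖ ≤
        (L * W ^ 2 * M + L * W ^ 4) * ε ^ 4 := by
      calc _ ≤ ‖N v - nonlin α (lead μ a)‖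
            + ‖nonlin α (lead μ a) - (2 : ℝ) • (lead μ a ^ 2 * bar (lead μ a))‖ :=
            norm_sub_le_norm_sub_add_norm_sub _ _ _
        _ ≤ L * (W * ε) ^ 2 * (M * ε ^ 3) + L * (W * ε) ^ 4 := by
            refine add_le_add (h1.1.trans (by gcongr)) h1.2
        _ = L * W ^ 2 * M * ε ^ 4 * ε + L * W ^ 4 * ε ^ 4 := by ring
        _ ≤ L * W ^ 2 * M * ε ^ 4 * 1 + L * W ^ 4 * ε ^ 4 := by gcongr
        _ = _ := by ring
    have h2 := abs_freqShift_sub_le ς n hε ha (N v)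
      ((2 : ℝ) • (lead μ a ^ 2 * bar (lead μ a))) j
    have e : ω j - (‖vec (n j)‖ ^ 2 + ρ
        + ς * (‖vec (n j)‖ ^ 2 * (4 * (∑ l, a l ^ 2) - 2 * a j ^ 2))) =
        freqShift ς n a (N v) j
          - freqShift ς n a ((2 : ℝ) • (lead μ a ^ 2 * bar (lead μ a))) j := by
      rw [hωj j, freqShift, freqShift]
      dsimp only
      rw [coeff_smul, coeff_cubic_lead]
      have := ha0 j
      field_simp
      ring
    rw [e]
    calc _ ≤ |ς| * ‖vec (n j)‖ ^ 2 *
          (‖N v - (2 : ℝ) • (lead μ a ^ 2 * bar (lead μ a))‖ / ε) := h2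
      _ ≤ P * ((L * W ^ 2 * M + L * W ^ 4) * ε ^ 4 / ε) := by
          gcongr
          exact Finset.single_le_sum (f := fun j => |ς| * ‖vec (n j)‖ ^ 2)
            (fun i _ => by positivity) (Finset.mem_univ j)
      _ = P * (L * W ^ 2 * M + L * W ^ 4) * ε ^ 3 := by field_simp
      _ ≤ _ := by gcongr; linarith

end LyapunovSchmidt

/-! ### Differentiating series of plane waves. -/

section ExpSeries

open Wiener

section expSeries

variable {V : Type*} [NormedAddCommGroup V] [NormedSpace ℝ V] {ι : Type*}

/-- The plane wave with phase `ℓ`. -/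
def wave (ℓ : V →L[ℝ] ℝ) (x : V) : ℂ := Complex.exp (Complex.I * (ℓ x : ℝ))

lemma hasFDerivAt_wave (ℓ : V →L[ℝ] ℝ) (x : V) :
    HasFDerivAt (wave ℓ) (wave ℓ x • (Complex.I • Complex.ofRealCLM.comp ℓ)) x :=
  (((Complex.ofRealCLM.comp ℓ).hasFDerivAt).const_smul Complex.I).cexp

lemma contDiff_wave (ℓ : V →L[ℝ] ℝ) {N : WithTop ℕ∞} : ContDiff ℝ N (wave ℓ) :=
  (contDiff_const.mul (Complex.ofRealCLM.comp ℓ).contDiff).cexp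

lemma norm_wave (ℓ : V →L[ℝ] ℝ) (x : V) : ‖wave ℓ x‖ = 1 := by
  rw [wave, mul_comm]
  exact Complex.norm_exp_ofReal_mul_I _

/-- A plane wave is the one-variable exponential composed with `ℓ`, and each derivative brings out
one factor `ℓ`. -/
lemma norm_iteratedFDeriv_wave_le (ℓ : V →L[ℝ] ℝ) (m : ℕ) (x : V) :
    ‖iteratedFDeriv ℝ m (wave ℓ) x‖ ≤ ‖ℓ‖ ^ m := by
  have h1 : wave ℓ = wave (ContinuousLinearMap.id ℝ ℝ) ∘ ℓ := rfl
  have h2 : ∀ s : ℝ, iteratedDeriv m (wave (ContinuousLinearMap.id ℝ ℝ)) s =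
      Complex.I ^ m * wave (ContinuousLinearMap.id ℝ ℝ) s := by
    induction m with
    | zero => simp
    | succ m ih =>
      intro s
      rw [iteratedDeriv_succ, funext ih, deriv_const_mul_field]
      have := (hasFDerivAt_wave (ContinuousLinearMap.id ℝ ℝ) s).hasDerivAt.deriv
      rw [this]
      simp
      ring
  rw [h1, ContinuousLinearMap.iteratedFDeriv_comp_right ℓ (contDiff_wave _) x le_rfl]
  refine (ContinuousMultilinearMap.norm_compContinuousLinearMap_le _ _).trans ?_
  rw [norm_iteratedFDeriv_eq_norm_iteratedDeriv, h2]
  simp [norm_wave]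

lemma iteratedFDeriv_two_wave (ℓ : V →L[ℝ] ℝ) (x e : V) :
    iteratedFDeriv ℝ 2 (wave ℓ) x ![e, e] = -((ℓ e : ℂ) ^ 2) * wave ℓ x := by
  rw [iteratedFDeriv_two_apply]
  have h1 : fderiv ℝ (wave ℓ) = fun x => wave ℓ x • (Complex.I • Complex.ofRealCLM.comp ℓ) :=
    funext fun x => (hasFDerivAt_wave ℓ x).fderiv
  have h2 : HasFDerivAt (fderiv ℝ (wave ℓ))
      ((wave ℓ x • (Complex.I • Complex.ofRealCLM.comp ℓ)).smulRight
        (Complex.I • Complex.ofRealCLM.comp ℓ)) x := by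
    rw [h1]
    exact (hasFDerivAt_wave ℓ x).smul_const (Complex.I • Complex.ofRealCLM.comp ℓ : V →L[ℝ] ℂ)
  rw [h2.fderiv]
  simp
  linear_combination (ℓ e : ℂ) ^ 2 * wave ℓ x * Complex.I_sq

variable {a : ι → ℂ} {ℓ : ι → V →L[ℝ] ℝ}

/-- One bound for all orders up to two, so that a single summability condition serves them all. -/
lemma norm_iteratedFDeriv_const_mul_wave_le (a : ℂ) (ℓ : V →L[ℝ] ℝ) {m : ℕ} (hm : m ≤ 2) (x : V) :
    ‖iteratedFDeriv ℝ m (fun y => a * wave ℓ y) x‖ ≤ ‖a‖ * (1 + ‖ℓ‖) ^ 2 := by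
  have h : (fun y => a * wave ℓ y) = a • wave ℓ := rfl
  rw [h, iteratedFDeriv_const_smul_apply (contDiff_wave ℓ).contDiffAt, norm_smul]
  gcongr
  refine (norm_iteratedFDeriv_wave_le ℓ m x).trans ?_
  calc ‖ℓ‖ ^ m ≤ (1 + ‖ℓ‖) ^ m := by gcongr; linarith
    _ ≤ (1 + ‖ℓ‖) ^ 2 := pow_le_pow_right₀ (by linarith [norm_nonneg ℓ]) hm

lemma contDiff_tsum_wave (h : Summable fun k => ‖a k‖ * (1 + ‖ℓ k‖) ^ 2) :
    ContDiff ℝ 2 fun x => ∑' k, a k * wave (ℓ k) x :=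
  contDiff_tsum (N := 2) (fun k => contDiff_const.mul (contDiff_wave (ℓ k))) (fun _ _ => h)
    fun _ k x hm => norm_iteratedFDeriv_const_mul_wave_le (a k) (ℓ k) (by exact_mod_cast hm) x

lemma iteratedFDeriv_two_tsum_wave (h : Summable fun k => ‖a k‖ * (1 + ‖ℓ k‖) ^ 2) (x e : V) :
    HasSum (fun k => -((ℓ k e : ℂ) ^ 2) * (a k * wave (ℓ k) x))
      (iteratedFDeriv ℝ 2 (fun x => ∑' k, a k * wave (ℓ k) x) x ![e, e]) := by
  have hb : ∀ (m : ℕ) k x, (m : ℕ∞) ≤ 2 → ‖iteratedFDeriv ℝ m (fun y => a k * wave (ℓ k) y) x‖ ≤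
      ‖a k‖ * (1 + ‖ℓ k‖) ^ 2 := fun m k x hm =>
    norm_iteratedFDeriv_const_mul_wave_le (a k) (ℓ k) (by exact_mod_cast hm) x
  rw [iteratedFDeriv_tsum_apply (N := 2) (k := 2)
    (fun k => contDiff_const.mul (contDiff_wave (ℓ k))) (fun _ _ => h) hb le_rfl x]
  have hs : Summable fun k => iteratedFDeriv ℝ 2 (fun y => a k * wave (ℓ k) y) x :=
    h.of_norm_bounded fun k => hb 2 k x le_rfl
  have := hs.hasSum.mapL (ContinuousMultilinearMap.apply ℝ (fun _ : Fin 2 => V) ℂ ![e, e])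
  refine this.congr_fun fun k => ?_
  have h' : (fun y => a k * wave (ℓ k) y) = a k • wave (ℓ k) := rfl
  rw [ContinuousMultilinearMap.apply_apply, h',
    iteratedFDeriv_const_smul_apply (contDiff_wave (ℓ k)).contDiffAt,
    smul_apply, iteratedFDeriv_two_wave, smul_eq_mul]
  ring

lemma hasSum_deriv_tsum_wave {ν : ι → ℝ} (h : Summable fun k => ‖a k‖ * |ν k|)
    (h0 : Summable fun k => ‖a k‖) (t : ℝ) :
    HasSum (fun k => Complex.I * ν k * (a k * Complex.exp (Complex.I * (ν k * t : ℝ))))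
      (deriv (fun t : ℝ => ∑' k, a k * Complex.exp (Complex.I * (ν k * t : ℝ))) t) := by
  have hd : ∀ k (t : ℝ), HasDerivAt (fun t : ℝ => a k * Complex.exp (Complex.I * (ν k * t : ℝ)))
      (Complex.I * ν k * (a k * Complex.exp (Complex.I * (ν k * t : ℝ)))) t := by
    intro k t
    have h1 : HasDerivAt (fun t : ℝ => Complex.I * ((ν k * t : ℝ) : ℂ)) (Complex.I * ν k) t := by
      have := (((hasDerivAt_id t).const_mul (ν k)).ofReal_comp).const_mul Complex.I
      simpa using this
    exact (h1.cexp.const_mul (a k)).congr_deriv (by ring)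
  have hn : ∀ k (t : ℝ), ‖Complex.exp (Complex.I * (ν k * t : ℝ))‖ = 1 := fun k t => by
    rw [mul_comm]
    exact Complex.norm_exp_ofReal_mul_I _
  have hb : ∀ k (t : ℝ), ‖Complex.I * ν k * (a k * Complex.exp (Complex.I * (ν k * t : ℝ)))‖ ≤
      ‖a k‖ * |ν k| := fun k t => by
    rw [norm_mul, norm_mul, norm_mul, hn, Complex.norm_I, Complex.norm_real, Real.norm_eq_abs]
    exact le_of_eq (by ring)
  rw [(hasDerivAt_tsum h hd hb (y₀ := 0)
    (h0.of_norm_bounded fun k => by rw [norm_mul, hn, mul_one]) t).deriv]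
  exact (h.of_norm_bounded fun k => hb k t).hasSum

end expSeries

end ExpSeries

/-! ### From coefficients to a classical solution. -/

section Field

open Wiener

variable {d b : ℕ} {μ : ℝ≥0}

/-- The character `k ↦ e^{i(∑ k_j n_j · x + k·ω t)}`. -/
def chi (n : Fin b → Fin d → ℤ) (ω : E b) (t : ℝ) (x : E d) (k : Fin b → ℤ) : ℂ :=
  Complex.exp (Complex.I * ((inner ℝ (vec (mode n k)) x + inner ℝ (vec k) ω * t : ℝ) : ℂ))

lemma norm_chi (n : Fin b → Fin d → ℤ) (ω : E b) (t : ℝ) (x : E d) (k : Fin b → ℤ) :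
    ‖chi n ω t x k‖ = 1 := by
  rw [chi, mul_comm]
  exact Complex.norm_exp_ofReal_mul_I _

lemma chi_add (n : Fin b → Fin d → ℤ) (ω : E b) (t : ℝ) (x : E d) (k l : Fin b → ℤ) :
    chi n ω t x (k + l) = chi n ω t x k * chi n ω t x l := by
  rw [chi, chi, chi, ← Complex.exp_add, vec_mode_eq, vec_mode_eq, vec_mode_eq, vec_add, map_add,
    inner_add_left, inner_add_left]
  congr 1
  push_cast
  ring

lemma chi_neg (n : Fin b → Fin d → ℤ) (ω : E b) (t : ℝ) (x : E d) (k : Fin b → ℤ) :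
    chi n ω t x (-k) = conj (chi n ω t x k) := by
  rw [chi, chi, ← Complex.exp_conj, vec_mode_eq, vec_mode_eq, vec_neg, map_neg,
    inner_neg_left, inner_neg_left, map_mul, Complex.conj_I, Complex.conj_ofReal]
  congr 1
  push_cast
  ring

/-- The function with Fourier coefficients `c` along the modes `n` and the frequencies `ω`. -/
def field (n : Fin b → Fin d → ℤ) (ω : E b) (c : Wiener (Fin b → ℤ) μ) (t : ℝ) (x : E d) : ℂ :=
  eval (chi n ω t x) (norm_chi n ω t x) c

lemma hasSum_field (n : Fin b → Fin d → ℤ) (ω : E b) (c : Wiener (Fin b → ℤ) μ) (t : ℝ) (x : E d) :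
    HasSum (fun k => (coeff c k : ℂ) * chi n ω t x k) (field n ω c t x) :=
  hasSum_eval _ _ c

/-- The exponential weight dominates quadratic growth: `1 + f k` is at most a constant times
`e^{μ‖k‖/2}`, whose square is the weight. This makes every field, including that of the nonlinear
term, twice differentiable. -/
lemma summable_coeff_mul_one_add_sq (hμ : 0 < μ) (c : Wiener (Fin b → ℤ) μ)
    {f : (Fin b → ℤ) → ℝ} {C : ℝ} (hC : 0 ≤ C) (hf0 : ∀ k, 0 ≤ f k) (hf : ∀ k, f k ≤ C * ‖k‖) :
    Summable fun k => |coeff c k| * (1 + f k) ^ 2 := by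
  refine Summable.of_nonneg_of_le (fun k => by positivity) (fun k => ?_)
    ((hasSum_norm c).summable.mul_right ((1 + 2 * C / μ) ^ 2))
  have hμ' : (0 : ℝ) < μ := hμ
  have h1 : 1 + f k ≤ (1 + 2 * C / μ) * Real.exp (μ * ‖k‖ / 2) := by
    have e1 := Real.add_one_le_exp (μ * ‖k‖ / 2)
    have e2 : 0 ≤ μ * ‖k‖ / 2 := by positivity
    have e3 : 0 ≤ 2 * C / μ := by positivity
    calc 1 + f k ≤ 1 + C * ‖k‖ := by linarith [hf k]
      _ = 1 + 2 * C / μ * (μ * ‖k‖ / 2) := by field_simp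
      _ ≤ (1 + 2 * C / μ) * (μ * ‖k‖ / 2 + 1) := by nlinarith
      _ ≤ _ := by gcongr
  have h2 : (1 + f k) ^ 2 ≤ (1 + 2 * C / μ) ^ 2 * wt μ k := by
    have : 0 ≤ 1 + f k := by linarith [hf0 k]
    calc (1 + f k) ^ 2 ≤ ((1 + 2 * C / μ) * Real.exp (μ * ‖k‖ / 2)) ^ 2 := by gcongr
      _ = _ := by rw [mul_pow, ← Real.exp_nat_mul, wt]; congr 2; push_cast; ring
  calc |coeff c k| * (1 + f k) ^ 2 ≤ |coeff c k| * ((1 + 2 * C / μ) ^ 2 * wt μ k) := by gcongr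
    _ = _ := by ring

lemma norm_real_cast (x : ℝ) : ‖(x : ℂ)‖ = |x| := by rw [Complex.norm_real, Real.norm_eq_abs]

lemma abs_inner_vec_le (ω : E b) (k : Fin b → ℤ) : |inner ℝ (vec k) ω| ≤ b * ‖ω‖ * ‖k‖ := by
  calc _ ≤ ‖vec k‖ * ‖ω‖ := abs_real_inner_le_norm _ _
    _ ≤ b * ‖k‖ * ‖ω‖ := by gcongr; exact norm_vec_le k
    _ = _ := by ring

lemma contDiff_field (hμ : 0 < μ) (n : Fin b → Fin d → ℤ) (ω : E b) (c : Wiener (Fin b → ℤ) μ) :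
    ContDiff ℝ 2 fun p : ℝ × E d => field n ω c p.1 p.2 := by
  set ℓ : (Fin b → ℤ) → ℝ × E d →L[ℝ] ℝ := fun k =>
    (innerSL ℝ (vec (mode n k))).comp (ContinuousLinearMap.snd ℝ ℝ (E d))
      + (inner ℝ (vec k) ω) • ContinuousLinearMap.fst ℝ ℝ (E d) with hℓ
  obtain ⟨C, hC, hm⟩ := exists_norm_vec_mode_le n
  have hb : ∀ k, ‖ℓ k‖ ≤ (C + b * ‖ω‖) * ‖k‖ := by
    intro k
    refine (norm_add_le _ _).trans ?_
    rw [add_mul]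
    refine add_le_add ?_ ?_
    · refine (ContinuousLinearMap.opNorm_comp_le _ _).trans ?_
      rw [innerSL_apply_norm]
      calc _ ≤ ‖vec (mode n k)‖ * 1 := by gcongr; exact ContinuousLinearMap.norm_snd_le _ _ _
        _ ≤ _ := by rw [mul_one]; exact hm k
    · rw [norm_smul, Real.norm_eq_abs]
      calc _ ≤ |inner ℝ (vec k) ω| * 1 := by gcongr; exact ContinuousLinearMap.norm_fst_le _ _ _
        _ ≤ _ := by rw [mul_one]; exact abs_inner_vec_le ω k
  have hs : Summable fun k => ‖(coeff c k : ℂ)‖ * (1 + ‖ℓ k‖) ^ 2 := by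
    simp only [norm_real_cast]
    exact summable_coeff_mul_one_add_sq hμ c (by positivity) (fun k => norm_nonneg _) hb
  have e : (fun p : ℝ × E d => field n ω c p.1 p.2) =
      fun p => ∑' k, (coeff c k : ℂ) * wave (ℓ k) p :=
    funext fun p => (hasSum_field n ω c p.1 p.2).tsum_eq.symm
  rw [e]
  exact contDiff_tsum_wave hs

lemma hasSum_laplacian_field (hμ : 0 < μ) (n : Fin b → Fin d → ℤ) (ω : E b)
    (c : Wiener (Fin b → ℤ) μ) (t : ℝ) (x : E d) :
    HasSum (fun k => -(‖vec (mode n k)‖ ^ 2 : ℝ) * ((coeff c k : ℂ) * chi n ω t x k))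
      (Laplacian.laplacian (field n ω c t) x) := by
  set ℓ : (Fin b → ℤ) → E d →L[ℝ] ℝ := fun k => innerSL ℝ (vec (mode n k)) with hℓ
  set a : (Fin b → ℤ) → ℂ := fun k =>
    coeff c k * Complex.exp (Complex.I * (inner ℝ (vec k) ω * t : ℝ)) with ha
  have hterm : ∀ y k, a k * wave (ℓ k) y = (coeff c k : ℂ) * chi n ω t y k := by
    intro y k
    rw [ha, chi, wave, hℓ]
    dsimp only
    rw [innerSL_apply_apply, mul_assoc, ← Complex.exp_add]
    congr 2
    push_cast
    ring
  obtain ⟨C, hC, hm⟩ := exists_norm_vec_mode_le n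
  have hs : Summable fun k => ‖a k‖ * (1 + ‖ℓ k‖) ^ 2 := by
    have : ∀ k, ‖a k‖ = |coeff c k| := fun k => by
      rw [ha, norm_mul, norm_real_cast, mul_comm Complex.I, Complex.norm_exp_ofReal_mul_I, mul_one]
    simp only [this]
    exact summable_coeff_mul_one_add_sq hμ c hC.le (fun k => norm_nonneg _)
      fun k => by rw [hℓ, innerSL_apply_norm]; exact hm k
  have hf : field n ω c t = fun y => ∑' k, a k * wave (ℓ k) y := by
    funext y
    simp only [hterm]
    exact (hasSum_field n ω c t y).tsum_eq.symm
  rw [InnerProductSpace.laplacian_eq_iteratedFDeriv_orthonormalBasis _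
    (EuclideanSpace.basisFun (Fin d) ℝ), hf]
  have := hasSum_sum (s := Finset.univ) fun (i : Fin d) _ =>
    iteratedFDeriv_two_tsum_wave hs x (EuclideanSpace.basisFun (Fin d) ℝ i)
  refine this.congr_fun fun k => ?_
  rw [← Finset.sum_mul, hterm, EuclideanSpace.norm_sq_eq, Finset.sum_neg_distrib]
  congr 2
  push_cast
  refine Finset.sum_congr rfl fun i _ => ?_
  rw [hℓ, Real.norm_eq_abs, ← Complex.ofReal_pow, sq_abs]
  simp [EuclideanSpace.inner_single_right]

lemma hasSum_deriv_field (hμ : 0 < μ) (n : Fin b → Fin d → ℤ) (ω : E b)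
    (c : Wiener (Fin b → ℤ) μ) (t : ℝ) (x : E d) :
    HasSum (fun k => Complex.I * (inner ℝ (vec k) ω : ℝ) * ((coeff c k : ℂ) * chi n ω t x k))
      (deriv (fun t' => field n ω c t' x) t) := by
  set a : (Fin b → ℤ) → ℂ := fun k =>
    coeff c k * Complex.exp (Complex.I * (inner ℝ (vec (mode n k)) x : ℝ)) with ha
  have hterm : ∀ (t : ℝ) k, a k * Complex.exp (Complex.I * (inner ℝ (vec k) ω * t : ℝ)) =
      (coeff c k : ℂ) * chi n ω t x k := by
    intro t k
    rw [ha, chi]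
    dsimp only
    rw [mul_assoc, ← Complex.exp_add]
    congr 2
    push_cast
    ring
  have hna : ∀ k, ‖a k‖ = |coeff c k| := fun k => by
    rw [ha, norm_mul, norm_real_cast, mul_comm Complex.I, Complex.norm_exp_ofReal_mul_I, mul_one]
  have hs := summable_coeff_mul_one_add_sq hμ c (f := fun k => |inner ℝ (vec k) ω|)
    (C := b * ‖ω‖) (by positivity) (fun k => abs_nonneg _) (abs_inner_vec_le ω)
  have hf : (fun t' => field n ω c t' x) =
      fun t : ℝ => ∑' k, a k * Complex.exp (Complex.I * (inner ℝ (vec k) ω * t : ℝ)) := by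
    funext t'
    simp only [hterm]
    exact (hasSum_field n ω c t' x).tsum_eq.symm
  rw [hf]
  have := hasSum_deriv_tsum_wave (a := a) (ν := fun k => inner ℝ (vec k) ω)
    (hs.of_nonneg_of_le (fun k => by positivity) fun k => by
      rw [hna]
      gcongr
      nlinarith [abs_nonneg (inner ℝ (vec k) ω : ℝ)])
    (hs.of_nonneg_of_le (fun k => by positivity) fun k => by
      rw [hna]
      refine le_mul_of_one_le_right (abs_nonneg _) ?_
      nlinarith [abs_nonneg (inner ℝ (vec k) ω : ℝ)]) t
  refine this.congr_fun fun k => ?_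
  rw [hterm]

lemma field_nonlin {α : ℕ → ℕ → ℝ} {r : ℝ} (hr : 0 < r) (hα : ConvergesAt α r)
    (n : Fin b → Fin d → ℤ) (ω : E b) {c : Wiener (Fin b → ℤ) μ} (hc : ‖c‖ ≤ r / 4) (t : ℝ)
    (x : E d) : dHbar α (field n ω c t x) = field n ω (nonlin α c) t x :=
  (eval_nonlin hr hα (norm_chi n ω t x) (chi_add n ω t x) (chi_neg n ω t x) hc).symm

theorem isSolution_field (hμ : 0 < μ) {ς ρ : ℝ} {α : ℕ → ℕ → ℝ} {r : ℝ} (hr : 0 < r)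
    (hα : ConvergesAt α r) (n : Fin b → Fin d → ℤ) (ω : E b) {c : Wiener (Fin b → ℤ) μ}
    (hc : ‖c‖ ≤ r / 4)
    (heq : ∀ k, divisor ρ n ω k * coeff c k
      + ς * ‖vec (mode n k)‖ ^ 2 * coeff (nonlin α c) k = 0) :
    IsSolution ς ρ α (field n ω c) where
  contDiff := contDiff_field hμ n ω c
  small := ⟨r, hr, hα, fun t x => (norm_eval_le _ _ _).trans_lt (by linarith)⟩
  eqn t x := by
    have e : (fun y => dHbar α (field n ω c t y)) = field n ω (nonlin α c) t :=
      funext fun y => field_nonlin hr hα n ω hc t y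
    rw [e]
    have h := ((((hasSum_deriv_field hμ n ω c t x).mul_left Complex.I).sub
      (hasSum_laplacian_field hμ n ω c t x)).add
      ((hasSum_field n ω c t x).mul_left (ρ : ℂ))).sub
      ((hasSum_laplacian_field hμ n ω (nonlin α c) t x).mul_left (ς : ℂ))
    refine h.unique ?_
    refine hasSum_zero.congr_fun fun k => ?_
    have h0 : (divisor ρ n ω k : ℂ) * coeff c k
        + ς * ‖vec (mode n k)‖ ^ 2 * coeff (nonlin α c) k = 0 := by exact_mod_cast heq k
    rw [divisor] at h0
    push_cast at h0 ⊢
    -- Here `i ∂_t` acts as `i · i (k·ω) = -k·ω`, hence the use of `Complex.I_sq`.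
    linear_combination (chi n ω t x k) * h0
      + (inner ℝ (vec k) ω : ℝ) * coeff c k * chi n ω t x k * Complex.I_sq

end Field

/-! ### Weighted norms and persistence. -/

section Persistence

open Wiener

variable {d b : ℕ} {μ : ℝ≥0}

open Classical in
/-- The Fourier coefficients on `ℤ^d × ℤ^b` of the function `field n ω c`. -/
def fullCoeff (n : Fin b → Fin d → ℤ) (c : Wiener (Fin b → ℤ) μ)
    (p : (Fin d → ℤ) × (Fin b → ℤ)) : ℂ :=
  if p.1 = mode n p.2 then (coeff c p.2 : ℂ) else 0

/-- On the graph of `mode n`, `|(n, k)| ≤ (C + b) ‖k‖`, and `N ^ (2s) ≤ e^{2sN}` trades the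
polynomial weight for exponential rate; hence `μ = (σ + s)(C + b)`. -/
lemma exists_weight_le (σ s : ℝ) (hσ : 0 < σ) (hs : 0 < s) (n : Fin b → Fin d → ℤ) :
    ∃ μ : ℝ≥0, 0 < μ ∧ ∀ k, weight σ s (mode n k, k) ≤ wt μ k ^ 2 := by
  obtain ⟨C, hC, hm⟩ := exists_norm_vec_mode_le n
  have hμ : 0 < (σ + s) * (C + b) := by positivity
  refine ⟨((σ + s) * (C + b)).toNNReal, Real.toNNReal_pos.2 hμ, fun k => ?_⟩
  rw [weight]
  dsimp only
  set N : ℝ := √(‖vec (mode n k)‖ ^ 2 + ‖vec k‖ ^ 2) with hN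
  have hN0 : 0 ≤ N := Real.sqrt_nonneg _
  have hNk : N ≤ (C + b) * ‖k‖ := by
    refine Real.sqrt_le_iff.2 ⟨by positivity, ?_⟩
    have h1 := hm k
    have h2 := norm_vec_le k
    calc _ ≤ (C * ‖k‖) ^ 2 + (b * ‖k‖) ^ 2 := by gcongr
      _ ≤ _ := by
        have : 0 ≤ C * b * ‖k‖ ^ 2 := by positivity
        nlinarith
  have h3 : N ^ (2 * s) ≤ Real.exp (N * (2 * s)) := by
    rw [Real.exp_mul]
    refine Real.rpow_le_rpow hN0 ?_ (by positivity)
    linarith [Real.add_one_le_exp N]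
  calc N ^ (2 * s) * Real.exp (2 * σ * N) ≤ Real.exp (N * (2 * s)) * Real.exp (2 * σ * N) := by
        gcongr
    _ = Real.exp (2 * ((σ + s) * N)) := by rw [← Real.exp_add]; congr 1; ring
    _ ≤ Real.exp (2 * ((σ + s) * ((C + b) * ‖k‖))) := by gcongr
    _ = _ := by
        rw [wt, ← Real.exp_nat_mul, Real.coe_toNNReal _ hμ.le]
        congr 1
        push_cast
        ring

theorem persists_field (hμ : 0 < μ) {ς ρ : ℝ} {α : ℕ → ℕ → ℝ} {r : ℝ} (hr : 0 < r)
    (hα : ConvergesAt α r) {n : Fin b → Fin d → ℤ} {a ω : E b} {v : Wiener (Fin b → ℤ) μ}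
    (hc : ‖lead μ a + v‖ ≤ r / 4) (hres : ∀ j, coeff v (Pi.single j 1) = 0)
    (heq : ∀ k, divisor ρ n ω k * coeff (lead μ a + v) k
      + ς * ‖vec (mode n k)‖ ^ 2 * coeff (nonlin α (lead μ a + v)) k = 0)
    {σ s κ C : ℝ} (hw : ∀ k, weight σ s (mode n k, k) ≤ wt μ k ^ 2)
    (hv : ‖v‖ < ‖a‖ ^ (1 + κ)) (hω : ‖ω - omega0 ρ n‖ ≤ C * ‖a‖ ^ 2) :
    Persists ς ρ α σ s κ C n a ω := by
  classical
  set g : (Fin b → ℤ) → (Fin d → ℤ) × (Fin b → ℤ) := fun k => (mode n k, k) with hg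
  have hginj : Function.Injective g := fun k l h => congrArg Prod.snd h
  have hrange : ∀ p, p ∉ Set.range g → p.1 ≠ mode n p.2 := fun p hp h =>
    hp ⟨p.2, Prod.ext h.symm rfl⟩
  have hnorm : ∀ p, 0 ≤ remainderTerm σ s n (fullCoeff n (lead μ a + v)) p := by
    intro p
    rw [remainderTerm]
    split_ifs
    · exact le_rfl
    · rw [weight]; positivity
  -- Bounding one of the two factors `|v_k| wt k` by `‖v‖` leaves an `ℓ¹` series with sum `‖v‖²`, so
  -- the weighted `ℓ²` norm is at most `‖v‖`.
  have hterm : ∀ k, remainderTerm σ s n (fullCoeff n (lead μ a + v)) (g k) ≤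
      ‖v‖ * (|coeff v k| * wt μ k) := by
    intro k
    have hnn : 0 ≤ |coeff v k| * wt μ k := mul_nonneg (abs_nonneg _) (wt_pos k).le
    rw [remainderTerm]
    split_ifs with h
    · positivity
    · have hk : ¬∃ j, k = Pi.single j 1 := by
        rintro ⟨j, rfl⟩
        exact h ⟨j, by rw [hg]; simp only [mode_single]⟩
      have e : fullCoeff n (lead μ a + v) (g k) = coeff v k := by
        rw [fullCoeff, hg, if_pos rfl, coeff_add, coeff_lead_of_ne a hk, zero_add]
      rw [e, norm_real_cast]
      calc |coeff v k| ^ 2 * weight σ s (g k) ≤ |coeff v k| ^ 2 * wt μ k ^ 2 := by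
            gcongr
            exact hw k
        _ = (|coeff v k| * wt μ k) * (|coeff v k| * wt μ k) := by ring
        _ ≤ _ := by gcongr; exact abs_coeff_mul_wt_le v k
  have hzero : ∀ p, p ∉ Set.range g → remainderTerm σ s n (fullCoeff n (lead μ a + v)) p = 0 := by
    intro p hp
    rw [remainderTerm, fullCoeff, if_neg (hrange p hp)]
    simp
  have hsumv := (hasSum_norm v).mul_left ‖v‖
  have hsum : Summable (remainderTerm σ s n (fullCoeff n (lead μ a + v))) :=
    (hginj.summable_iff hzero).1
      (hsumv.summable.of_nonneg_of_le (fun k => hnorm _) hterm)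
  refine ⟨field n ω (lead μ a + v), fullCoeff n (lead μ a + v),
    isSolution_field hμ hr hα n ω hc heq, fun t x => ?_, fun j => ?_, hsum, ?_, hω⟩
  · refine (hginj.hasSum_iff fun p hp => ?_).1
      ((hasSum_field n ω (lead μ a + v) t x).congr_fun fun k => ?_)
    · rw [fullCoeff, if_neg (hrange p hp), zero_mul]
    · simp only [Function.comp_apply, hg, fullCoeff, if_true, chi]
  · rw [fullCoeff, if_pos (mode_single n j).symm, coeff_add, coeff_lead_single, hres, add_zero]
  · refine lt_of_le_of_lt (Real.sqrt_le_iff.2 ⟨norm_nonneg v, ?_⟩) hv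
    rw [← hginj.tsum_eq (Function.support_subset_iff'.2 hzero), sq, ← hsumv.tsum_eq]
    exact ((hginj.summable_iff hzero).2 hsum).tsum_le_tsum hterm hsumv.summable

theorem exists_persists {ς ρ : ℝ} (hρ : Diophantine ρ) {α : ℕ → ℕ → ℝ} (hα : Admissible α)
    (hb : 1 ≤ b) {n : Fin b → Fin d → ℤ} (hli : LinearIndependent ℝ fun j => vec (n j))
    (hn : Nonresonant n) {σ s κ : ℝ} (hσ : 0 < σ) (hs : 0 < s) (hκ : 0 < κ) (hκ2 : κ < 2) :
    ∃ ε₀ C : ℝ, 0 < ε₀ ∧ ∀ ε : ℝ, 0 < ε → ε < ε₀ → ∀ a : E b,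
      (∀ j, ε ≤ |a j|) → (∀ j, |a j| ≤ 2 * ε) →
      ∃ ω : E b, Persists ς ρ α σ s κ C n a ω ∧
        ∀ j, |ω j - (‖vec (n j)‖ ^ 2 + ρ
          + ς * (‖vec (n j)‖ ^ 2 * (4 * (∑ l, a l ^ 2) - 2 * a j ^ 2)))| ≤ C * ‖a‖ ^ 3 := by
  obtain ⟨-, r, hr, hr'⟩ := hα
  obtain ⟨μ, hμ, hw⟩ := exists_weight_le σ s hσ hs n
  obtain ⟨ε₁, C, hε₁, hC, H⟩ := exists_lyapunovSchmidt_solution μ ς hρ hli hn hr hr'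
  have hκ' : 0 < 2 - κ := by linarith
  -- The second threshold says `C ε^{2-κ} < 1`, which turns `C ε³` into less than `ε^{1+κ}`.
  refine ⟨min ε₁ (C⁻¹ ^ (2 - κ)⁻¹), C, by positivity, fun ε hε hεlt a ha ha2 => ?_⟩
  obtain ⟨v, ω, hv, hc, hω, hres, heq, hfreq⟩ :=
    H ε hε (hεlt.trans_le (min_le_left _ _)) a ha ha2
  have hεa : ε ≤ ‖a‖ := (ha ⟨0, hb⟩).trans (PiLp.norm_apply_le a _)
  refine ⟨ω, persists_field hμ hr hr' hc hres heq hw ?_ (hω.trans (by gcongr)),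
    fun j => (hfreq j).trans (by gcongr)⟩
  have h1 : ε ^ (2 - κ) < C⁻¹ :=
    (Real.lt_rpow_inv_iff_of_pos hε.le (by positivity) hκ').1 (hεlt.trans_le (min_le_right _ _))
  calc ‖v‖ ≤ C * ε ^ 3 := hv
    _ = C * ε ^ (2 - κ) * ε ^ (1 + κ) := by
        rw [mul_assoc, ← Real.rpow_add hε, ← Real.rpow_natCast ε 3]
        congr 2
        push_cast
        ring
    _ < C * C⁻¹ * ε ^ (1 + κ) := by gcongr
    _ = ε ^ (1 + κ) := by field_simp
    _ ≤ ‖a‖ ^ (1 + κ) := Real.rpow_le_rpow hε.le hεa (by linarith)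

theorem persistsForSmallAmplitudes {ς ρ : ℝ} (hρ : Diophantine ρ) {α : ℕ → ℕ → ℝ}
    (hα : Admissible α) (hb : 1 ≤ b) {n : Fin b → Fin d → ℤ}
    (hli : LinearIndependent ℝ fun j => vec (n j)) (hn : Nonresonant n) :
    PersistsForSmallAmplitudes ς ρ α n := by
  intro σ s κ hσ hs hκ hκ2
  obtain ⟨ε₀, C, hε₀, H⟩ := exists_persists (ς := ς) hρ hα hb hli hn hσ
    ((by positivity : (0 : ℝ) ≤ (b : ℝ) / 2).trans_lt hs) hκ hκ2
  refine ⟨ε₀, C, hε₀, fun ε hε hlt a ha => H ε hε hlt a (fun j => ?_) fun j => ?_⟩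
  · exact (ha j).1.trans (le_abs_self _)
  · rw [abs_of_nonneg (hε.le.trans (ha j).1)]
    exact (ha j).2

/-! ### Geometric conditions that exclude resonances. -/

lemma nonresonant_one (n : Fin 1 → Fin d → ℤ) : Nonresonant n := by
  intro k hk _
  refine ⟨0, funext fun i => ?_⟩
  rw [Subsingleton.elim i 0]
  simpa using hk

/-- With `k 1 = 1 - k 0` the resonance equation becomes `k 0 (k 0 - 1) |n 0 - n 1|² = 0`. -/
lemma nonresonant_two {n : Fin 2 → Fin d → ℤ}
    (hli : LinearIndependent ℝ fun j => vec (n j)) : Nonresonant n := by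
  intro k hk h
  rw [Fin.sum_univ_two] at hk
  have hne : ‖vec (n 0) - vec (n 1)‖ ^ 2 ≠ 0 := by
    rw [pow_ne_zero_iff two_ne_zero, norm_ne_zero_iff, sub_ne_zero]
    exact fun h => zero_ne_one (hli.injective h)
  rw [vec_mode, Fin.sum_univ_two, Fin.sum_univ_two, norm_add_sq_real, norm_smul, norm_smul,
    real_inner_smul_left, real_inner_smul_right, Real.norm_eq_abs, Real.norm_eq_abs, mul_pow,
    mul_pow, sq_abs, sq_abs] at h
  have hk' : (k 1 : ℝ) = 1 - k 0 := by
    have : ((k 0 + k 1 : ℤ) : ℝ) = 1 := by rw [hk]; simp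
    push_cast at this
    linarith
  have h0 : ((k 0 : ℝ) * (k 0 - 1)) * ‖vec (n 0) - vec (n 1)‖ ^ 2 = 0 := by
    rw [norm_sub_sq_real]
    rw [hk'] at h
    linear_combination h
  rcases mul_eq_zero.1 ((mul_eq_zero.1 h0).resolve_right hne) with h1 | h1
  · have h1 : k 0 = 0 := by exact_mod_cast h1
    refine ⟨1, funext fun i => ?_⟩
    fin_cases i <;> simp <;> omega
  · have h1 : k 0 = 1 := by
      have : (k 0 : ℝ) = 1 := by linarith
      exact_mod_cast this
    refine ⟨0, funext fun i => ?_⟩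
    fin_cases i <;> simp <;> omega

lemma int_mul_sub_one_nonneg (m : ℤ) : (0 : ℝ) ≤ (m : ℝ) * (m - 1) := by
  have : 0 ≤ m * (m - 1) := by
    rcases le_or_gt m 0 with h | h
    · nlinarith
    · exact mul_nonneg h.le (by omega)
  exact_mod_cast this

lemma eq_zero_or_one_of_mul_sub_one {m : ℤ} (h : (m : ℝ) * (m - 1) = 0) : m = 0 ∨ m = 1 := by
  have : m * (m - 1) = 0 := by exact_mod_cast h
  rcases mul_eq_zero.1 this with h | h
  · exact Or.inl h
  · exact Or.inr (by omega)

lemma inner_pos_of_angle_lt {V : Type*} [NormedAddCommGroup V] [InnerProductSpace ℝ V] {x y : V}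
    (h : InnerProductGeometry.angle x y < Real.pi / 2) : 0 < inner ℝ x y := by
  have hcos : 0 < Real.cos (InnerProductGeometry.angle x y) :=
    Real.cos_pos_of_mem_Ioo ⟨by linarith [InnerProductGeometry.angle_nonneg x y, Real.pi_pos], h⟩
  have hx : x ≠ 0 := by
    rintro rfl
    rw [InnerProductGeometry.angle_zero_left] at h
    exact lt_irrefl _ h
  have hy : y ≠ 0 := by
    rintro rfl
    rw [InnerProductGeometry.angle_zero_right] at h
    exact lt_irrefl _ h
  rw [← InnerProductGeometry.cos_angle_mul_norm_mul_norm]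
  have := norm_pos_iff.2 hx
  have := norm_pos_iff.2 hy
  positivity

/-- Let `g_i` be the inner product of the two sides of the triangle at vertex `i`. Then `|n_i -
n_j|² = g_i + g_j`, so the resonance equation is `∑ g_i k_i (k_i - 1) = 0`. Acute angles make every
`g_i` positive, and each term must vanish. -/
lemma nonresonant_three {n : Fin 3 → Fin d → ℤ}
    (hangle : ∀ i j l : Fin 3, i ≠ j → i ≠ l → j ≠ l →
      InnerProductGeometry.angle (vec (n i) - vec (n j)) (vec (n i) - vec (n l)) < Real.pi / 2) :
    Nonresonant n := by
  intro k hk h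
  rw [Fin.sum_univ_three] at hk
  have p0 := inner_pos_of_angle_lt (hangle 0 1 2 (by decide) (by decide) (by decide))
  have p1 := inner_pos_of_angle_lt (hangle 1 0 2 (by decide) (by decide) (by decide))
  have p2 := inner_pos_of_angle_lt (hangle 2 0 1 (by decide) (by decide) (by decide))
  have hk' : (k 0 : ℝ) = 1 - k 1 - k 2 := by
    have : ((k 0 + k 1 + k 2 : ℤ) : ℝ) = 1 := by rw [hk]; simp
    push_cast at this
    linarith
  rw [vec_mode, Fin.sum_univ_three, Fin.sum_univ_three] at h
  set x := vec (n 0)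
  set y := vec (n 1)
  set z := vec (n 2)
  -- The expression `m (m - 1)` is invariant under `m ↦ 1 - m`, so `1 - k 0` may stand for `k 0`.
  have key : inner ℝ (x - y) (x - z) * (((1 - k 0 : ℤ) : ℝ) * ((1 - k 0 : ℤ) - 1))
      + inner ℝ (y - x) (y - z) * ((k 1 : ℝ) * (k 1 - 1))
      + inner ℝ (z - x) (z - y) * ((k 2 : ℝ) * (k 2 - 1)) = 0 := by
    rw [← real_inner_self_eq_norm_sq, ← real_inner_self_eq_norm_sq, ← real_inner_self_eq_norm_sq,
      ← real_inner_self_eq_norm_sq] at h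
    simp only [inner_add_left, inner_add_right, real_inner_smul_left, real_inner_smul_right,
      real_inner_comm x y, real_inner_comm x z, real_inner_comm y z, hk'] at h
    simp only [inner_sub_left, inner_sub_right, real_inner_comm x y,
      real_inner_comm y z]
    push_cast
    rw [hk']
    linear_combination h
  have q0 := mul_nonneg p0.le (int_mul_sub_one_nonneg (1 - k 0))
  have q1 := mul_nonneg p1.le (int_mul_sub_one_nonneg (k 1))
  have q2 := mul_nonneg p2.le (int_mul_sub_one_nonneg (k 2))
  have r0 := eq_zero_or_one_of_mul_sub_one (m := 1 - k 0)
    ((mul_eq_zero.1 (by linarith)).resolve_left p0.ne')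
  have r1 := eq_zero_or_one_of_mul_sub_one (m := k 1)
    ((mul_eq_zero.1 (by linarith)).resolve_left p1.ne')
  have r2 := eq_zero_or_one_of_mul_sub_one (m := k 2)
    ((mul_eq_zero.1 (by linarith)).resolve_left p2.ne')
  have : (k 0 = 1 ∧ k 1 = 0 ∧ k 2 = 0) ∨ (k 0 = 0 ∧ k 1 = 1 ∧ k 2 = 0) ∨
      (k 0 = 0 ∧ k 1 = 0 ∧ k 2 = 1) := by omega
  rcases this with ⟨h0, h1, h2⟩ | ⟨h0, h1, h2⟩ | ⟨h0, h1, h2⟩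
  · exact ⟨0, funext fun i => by fin_cases i <;> simp [h0, h1, h2]⟩
  · exact ⟨1, funext fun i => by fin_cases i <;> simp [h0, h1, h2]⟩
  · exact ⟨2, funext fun i => by fin_cases i <;> simp [h0, h1, h2]⟩

/-- By Pythagoras the resonance equation is `M ∑ k_j (k_j - 1) = 0`, so every `k_j` is `0` or `1`,
and `∑ k_j = 1` leaves a unit vector. -/
lemma nonresonant_of_orthogonal {n : Fin b → Fin d → ℤ} {M : ℝ} (hM : 0 < M)
    (hnorm : ∀ j, ‖vec (n j)‖ ^ 2 = M)
    (horth : ∀ j l, j ≠ l → inner ℝ (vec (n j)) (vec (n l)) = 0) : Nonresonant n := by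
  intro k hk h
  have e : ‖vec (mode n k)‖ ^ 2 = ∑ j, (k j : ℝ) ^ 2 * M := by
    rw [vec_mode, ← real_inner_self_eq_norm_sq, sum_inner]
    refine Finset.sum_congr rfl fun j _ => ?_
    rw [inner_sum, Finset.sum_eq_single j]
    · rw [real_inner_smul_left, real_inner_smul_right, real_inner_self_eq_norm_sq, hnorm]
      ring
    · intro l _ hl
      rw [real_inner_smul_left, real_inner_smul_right, horth j l hl.symm]
      ring
    · simp
  have hz : ∑ j, (k j : ℝ) * (k j - 1) = 0 := by
    simp only [e, hnorm, ← Finset.sum_mul] at h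
    have h' := mul_right_cancel₀ hM.ne' h
    simp only [mul_sub, mul_one, Finset.sum_sub_distrib, ← sq]
    linarith
  have hall := (Finset.sum_eq_zero_iff_of_nonneg fun j _ => int_mul_sub_one_nonneg (k j)).1 hz
  have h01 : ∀ j, k j = 0 ∨ k j = 1 := fun j =>
    eq_zero_or_one_of_mul_sub_one (hall j (Finset.mem_univ j))
  obtain ⟨j, hj⟩ : ∃ j, k j = 1 := by
    by_contra hne
    push Not at hne
    have : ∑ j, k j = 0 := Finset.sum_eq_zero fun j _ => (h01 j).resolve_right (hne j)
    omega
  refine ⟨j, funext fun i => ?_⟩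
  by_cases hij : i = j
  · rw [hij, hj, Pi.single_eq_same]
  · rw [Pi.single_eq_of_ne hij]
    refine (h01 i).resolve_right fun hi => ?_
    have hpair : k i + k j ≤ ∑ l, k l := by
      rw [← Finset.sum_pair hij]
      exact Finset.sum_le_sum_of_subset_of_nonneg (Finset.subset_univ _) fun l _ _ => by
        rcases h01 l with h | h <;> omega
    omega

theorem exists_persists_one {ς ρ : ℝ} (hρ : Diophantine ρ) {α : ℕ → ℕ → ℝ} (hα : Admissible α)
    (n : Fin d → ℤ) {σ s κ : ℝ} (hσ : 0 < σ) (hs : 0 < s) (hκ : 0 < κ) (hκ2 : κ < 2) :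
    ∃ ε₀ C : ℝ, 0 < ε₀ ∧ ∀ a : ℝ, a ≠ 0 → |a| < ε₀ →
      ∃ ω : ℝ,
        Persists ς ρ α σ s κ C (fun _ : Fin 1 => n)
          (WithLp.toLp 2 (fun _ => a)) (WithLp.toLp 2 (fun _ => ω)) ∧
        |ω - (‖vec n‖ ^ 2 + ρ + ς * (2 * a ^ 2 * ‖vec n‖ ^ 2))| ≤ C * |a| ^ 3 := by
  have hnorm : ∀ a : ℝ, ‖(WithLp.toLp 2 (fun _ => a) : E 1)‖ = |a| := fun a => by
    rw [EuclideanSpace.norm_eq]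
    simp [Real.sqrt_sq_eq_abs]
  -- The zero mode is not linearly independent, but `a e^{iρt}` is constant in space and solves the
  -- nonlinear equation exactly: here `v = 0`, `ω = ρ` and `C = 0`.
  by_cases hn : vec n = 0
  · obtain ⟨-, r, hr, hr'⟩ := hα
    obtain ⟨μ, hμ, hw⟩ := exists_weight_le σ s hσ hs (fun _ : Fin 1 => n)
    set W : ℝ := 2 * ∑ j : Fin 1, wt μ (Pi.single j 1 : Fin 1 → ℤ) with hW
    have hW0 : 0 < W := by
      rw [hW, Fin.sum_univ_one]
      exact mul_pos two_pos (wt_pos _)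
    refine ⟨r / 4 / W, 0, by positivity, fun a ha hlt => ⟨ρ, ?_, by simp [hn]⟩⟩
    have hmode : ∀ k, vec (mode (fun _ : Fin 1 => n) k) = 0 := fun k => by
      rw [vec_mode]; simp [hn]
    refine persists_field (μ := μ) (v := 0) hμ hr hr' ?_ (fun j => coeff_zero _) (fun k => ?_) hw
      ?_ ?_
    · rw [add_zero]
      refine (norm_lead_le (ε := |a|) _ fun j => ?_).trans ?_
      · have := abs_nonneg a
        change |a| ≤ 2 * |a|
        linarith
      · rw [← hW, mul_comm, ← le_div_iff₀ hW0]
        exact hlt.le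
    · rw [hmode, norm_zero]
      by_cases hk : ∃ j, k = Pi.single j 1
      · obtain ⟨j, rfl⟩ := hk
        rw [divisor, hmode, norm_zero, inner_vec, Fin.sum_univ_one, Subsingleton.elim j 0]
        simp
      · rw [add_zero, coeff_lead_of_ne _ hk]
        simp
    · rw [norm_zero, hnorm]
      have := abs_pos.2 ha
      positivity
    · have : (WithLp.toLp 2 (fun _ => ρ) : E 1) - omega0 ρ (fun _ : Fin 1 => n) = 0 := by
        ext j
        simp [omega0, hn]
      rw [this, norm_zero, zero_mul]
  · have hli : LinearIndependent ℝ fun j : Fin 1 => vec ((fun _ : Fin 1 => n) j) :=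
      linearIndependent_unique_iff.2 hn
    obtain ⟨ε₀, C, hε₀, H⟩ := exists_persists (ς := ς) hρ hα le_rfl hli (nonresonant_one _) hσ hs
      hκ hκ2
    refine ⟨ε₀, C, hε₀, fun a ha hlt => ?_⟩
    have ha0 := abs_pos.2 ha
    obtain ⟨ω, h1, h2⟩ := H |a| ha0 hlt (WithLp.toLp 2 (fun _ => a)) (fun _ => le_rfl)
      fun _ => by
        change |a| ≤ 2 * |a|
        linarith
    have hω : (WithLp.toLp 2 (fun _ => ω 0) : E 1) = ω := by
      ext j
      rw [Subsingleton.elim j 0]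
    refine ⟨ω 0, by rwa [hω], ?_⟩
    have := h2 0
    rw [hnorm, Fin.sum_univ_one] at this
    convert! this using 3
    ring

end Persistence

end QLS

end

theorem corollary1p2 (d : ℕ) (ς : ℝ) (hς : ς = 1 ∨ ς = -1) (ρ : ℝ) (hρ : QLS.Diophantine ρ)
    (α : ℕ → ℕ → ℝ) (hα : QLS.Admissible α) :
    -- (i) one mode
    (∀ n : Fin d → ℤ, ∀ σ s κ : ℝ, 0 < σ → 1 / 2 < s → 0 < κ → κ < 2 →
      ∃ ε₀ C : ℝ, 0 < ε₀ ∧ ∀ a : ℝ, a ≠ 0 → |a| < ε₀ →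
        ∃ ω : ℝ,
          QLS.Persists ς ρ α σ s κ C (fun _ : Fin 1 => n)
            (WithLp.toLp 2 (fun _ => a)) (WithLp.toLp 2 (fun _ => ω)) ∧
          |ω - (‖QLS.vec n‖ ^ 2 + ρ + ς * (2 * a ^ 2 * ‖QLS.vec n‖ ^ 2))| ≤ C * |a| ^ 3) ∧
    -- (ii) two modes that are not parallel
    (∀ n : Fin 2 → Fin d → ℤ, LinearIndependent ℝ (fun j => QLS.vec (n j)) →
      QLS.PersistsForSmallAmplitudes ς ρ α n) ∧
    -- (iii) three linearly independent modes that span an acute triangle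
    (∀ n : Fin 3 → Fin d → ℤ, LinearIndependent ℝ (fun j => QLS.vec (n j)) →
      (∀ i j l : Fin 3, i ≠ j → i ≠ l → j ≠ l →
        InnerProductGeometry.angle (QLS.vec (n i) - QLS.vec (n j))
          (QLS.vec (n i) - QLS.vec (n l)) < Real.pi / 2) →
      QLS.PersistsForSmallAmplitudes ς ρ α n) ∧
    -- (iv) mutually orthogonal modes of equal length
    (∀ (b : ℕ) (n : Fin b → Fin d → ℤ) (M : ℝ), 1 ≤ b → 0 < M →
      (∀ j, ‖QLS.vec (n j)‖ ^ 2 = M) →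
      (∀ j l, j ≠ l → inner ℝ (QLS.vec (n j)) (QLS.vec (n l)) = 0) →
      QLS.PersistsForSmallAmplitudes ς ρ α n) := by
  refine ⟨fun n σ s κ hσ hs hκ hκ2 =>
    QLS.exists_persists_one hρ hα n hσ (one_half_pos.trans hs) hκ hκ2,
    fun n hli => QLS.persistsForSmallAmplitudes hρ hα one_le_two hli (QLS.nonresonant_two hli),
    fun n hli hangle =>
      QLS.persistsForSmallAmplitudes hρ hα (by norm_num) hli (QLS.nonresonant_three hangle),
    fun b n M hb hM hnorm horth => QLS.persistsForSmallAmplitudes hρ hα hb ?_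
      (QLS.nonresonant_of_orthogonal hM hnorm horth)⟩
  refine linearIndependent_of_ne_zero_of_inner_eq_zero (fun j h => ?_) fun j l hjl => horth j l hjl
  have := hnorm j
  rw [h, norm_zero] at this
  norm_num at this
  exact hM.ne this
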